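/- Let \(S=[0,1]^2\) be the unit square, let \(d\) be the Euclidean distance, and let \(0<\epsilon_1\le\epsilon_2<\infty\), \(c_1,c_2>0\) and \(\alpha>0\) be constants. Let \(X_1,X_2,\ldots\) be i.i.d. random points of \(S\) with a (measurable) density \(f\) with respect to Lebesgue measure such that \(\epsilon_1\le f(x)\le\epsilon_2\) for all \(x\in S\). Let \(h\) be a measurable real-valued function on \(S\times S\) with \(c_1 d(x,y)\le h(x,y)=h(y,x)\le c_2 d(x,y)\) for all \(x,y\in S\). Let \(TSP_n\) be the minimum weight of a spanning cycle of the complete graph on the nodes \(X_1,\ldots,X_n\), where the weight of a cycle is the sum of the weights \(h(X_i,X_j)^{\alpha}\) of its edges \((X_i,X_j)\). Set \(\delta=\epsilon_2\) if \(\alpha\le 1\) and \(\delta=\epsilon_1\) if \(\alpha>1\). For \(A>0\) let \[p=1-e^{-\delta A^2}\Bigl(1+\delta A^2+\frac{\delta^2A^4}{2}\Bigr),\] let \(\tilde T\) and \(\hat T\) be geometric random variables on \(\{1,2,\ldots\}\) with success parameters \(p\) and \(1-p\) respectively (so that \(\mathbb P(\tilde T=j)=(1-p)^{j-1}p\) and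 \(\mathbb P(\hat T=j)=p^{j-1}(1-p)\) for \(j\ge1\)), and put \[C_1(A)=\frac{(c_1A)^{\alpha}}{A^2}\bigl(1-e^{-\epsilon_1A^2}\bigr)e^{-8\epsilon_2A^2},\qquad C_2(A)=(2c_2A)^{\alpha}\Bigl(1+\frac1{A^2}\bigl(\mathbb E\tilde T^{\alpha}+\mathbb E\hat T^{\alpha}\bigr)\Bigr).\] Then for every \(A>0\) and every integer \(k\ge1\) there is an \(n_0=n_0(A,k,\epsilon_1,\epsilon_2,\alpha,c_1,c_2)\) such that for all \(n\ge n_0\) (and all \(f\) and \(h\) as above) \[\mathbb P\Bigl(TSP_n\ge C_1(A)\,n^{1-\frac{\alpha}{2}}\Bigl(1-\frac{4\sqrt A}{n^{1/4}}\Bigr)\Bigr)\ge 1-e^{-n^{1/3}},\] \[\mathbb P\Bigl(TSP_n\le C_2(A)\,n^{1-\frac{\alpha}{2}}\Bigl(1+\frac{2}{n^{1/16}}\Bigr)\Bigr)\ge 1-\frac1{n^{2k}},\] and the \(k\)-th moment of \(TSP_n\) is finite with \[C_1^k(A)\Bigl(1-\frac{37k\sqrt A}{n^{1/4}}\Bigr)\le\mathbb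 E\left(\frac{TSP_n^k}{n^{k(1-\frac{\alpha}{2})}}\right)\le C_2^k(A)\Bigl(1+\frac{3k}{n^{1/16}}\Bigr).\] -/

import Mathlib

open MeasureTheory ProbabilityTheory

noncomputable section

/-- The closed unit square `S = [0,1]²` in the Euclidean plane. -/
def unitSquare : Set (EuclideanSpace ℝ (Fin 2)) := {p | ∀ i, p i ∈ Set.Icc (0 : ℝ) 1}

/-- The type of points of the unit square; `dist` is the Euclidean distance. -/
abbrev UnitSquare : Type := unitSquare

/-- Lebesgue measure on the unit square. -/
def squareVolume : Measure UnitSquare :=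
  Measure.comap Subtype.val (volume : Measure (EuclideanSpace ℝ (Fin 2)))

/-- `f` is a measurable function on the unit square with values in `[ε₁, ε₂]`. -/
structure IsBoundedDensity (ε₁ ε₂ : ℝ) (f : UnitSquare → ℝ) : Prop where
  measurable : Measurable f
  lower : ∀ x, ε₁ ≤ f x
  upper : ∀ x, f x ≤ ε₂

/-- `X 0, X 1, …` are i.i.d. random points of the unit square with density `f`
with respect to Lebesgue measure. -/
structure IsIIDWithDensity {Ω : Type*} [MeasurableSpace Ω] (P : Measure Ω)
    (f : UnitSquare → ℝ) (X : ℕ → Ω → UnitSquare) : Prop where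
  measurable : ∀ i, Measurable (X i)
  indep : iIndepFun X P
  law : ∀ i, P.map (X i) =
    squareVolume.withDensity (fun x => ENNReal.ofReal (f x))

/-- `h` is a measurable symmetric edge weight function on the unit square that is equivalent to
the Euclidean distance with constants `c₁` and `c₂`. -/
structure IsEdgeWeight (c₁ c₂ : ℝ) (h : UnitSquare → UnitSquare → ℝ) : Prop where
  measurable : Measurable (Function.uncurry h)
  symm : ∀ x y, h x y = h y x
  lower : ∀ x y, c₁ * dist x y ≤ h x y
  upper : ∀ x y, h x y ≤ c₂ * dist x y

/-- The weight, with exponent `α`, of the spanning cycle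
`(x (σ 0), x (σ 1), …, x (σ (n-1)), x (σ 0))` of the complete graph on the nodes
`x 0, …, x (n-1)`; `finRotate n` is the cyclic shift `j ↦ j + 1` of `Fin n`.
For `n ≥ 3` every spanning cycle is of this form. -/
def cycleWeight (h : UnitSquare → UnitSquare → ℝ) (α : ℝ) {n : ℕ} (x : Fin n → UnitSquare)
    (σ : Equiv.Perm (Fin n)) : ℝ :=
  ∑ j : Fin n, h (x (σ j)) (x (σ (finRotate n j))) ^ α

/-- The minimum weight of a spanning cycle through the nodes `x 0, …, x (n-1)`. -/
def tspWeight (h : UnitSquare → UnitSquare → ℝ) (α : ℝ) {n : ℕ} (x : Fin n → UnitSquare) : ℝ :=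
  Finset.univ.inf' Finset.univ_nonempty (cycleWeight h α x)

/-- `TSP_n`, the minimum weight of a spanning cycle through the first `n` random nodes. -/
def TSP {Ω : Type*} (h : UnitSquare → UnitSquare → ℝ) (α : ℝ) (X : ℕ → Ω → UnitSquare)
    (n : ℕ) (ω : Ω) : ℝ :=
  tspWeight h α (fun i : Fin n => X i ω)

/-- `𝔼 T ^ α` for a geometric random variable `T` with success parameter `p`, that is,
`ℙ (T = k) = (1 - p) ^ (k - 1) * p` for `k ≥ 1` (the series is indexed by `j = k - 1`). -/
def geomMoment (p α : ℝ) : ℝ := ∑' j : ℕ, (1 - p) ^ j * p * ((j : ℝ) + 1) ^ α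

/-- The series that defines `geomMoment` converges. -/
theorem summable_geomMoment {p : ℝ} (hp : 0 < p) (hp1 : p < 1) (α : ℝ) :
    Summable (fun j : ℕ => (1 - p) ^ j * p * ((j : ℝ) + 1) ^ α) := by
  have h0 : Summable (fun j : ℕ => ((j : ℝ)) ^ ⌈α⌉₊ * (1 - p) ^ j) :=
    summable_pow_mul_geometric_of_norm_lt_one _
      (by rw [Real.norm_eq_abs, abs_of_pos (by linarith)]; linarith)
  have h1 := ((summable_nat_add_iff 1).2 h0).mul_left (p / (1 - p))
  refine Summable.of_nonneg_of_le (fun j => ?_) (fun j => ?_) h1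
  · have : 0 < 1 - p := by linarith
    positivity
  · have hq : 0 < 1 - p := by linarith
    have hj : ((j : ℝ) + 1) ^ α ≤ ((j : ℝ) + 1) ^ ⌈α⌉₊ := by
      rw [← Real.rpow_natCast]
      exact Real.rpow_le_rpow_of_exponent_le (by linarith [j.cast_nonneg (α := ℝ)])
        (Nat.le_ceil α)
    have he : p / (1 - p) * (((j + 1 : ℕ) : ℝ) ^ ⌈α⌉₊ * (1 - p) ^ (j + 1))
        = (1 - p) ^ j * p * ((j : ℝ) + 1) ^ ⌈α⌉₊ := by
      have hne : 1 - p ≠ 0 := hq.ne'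
      push_cast
      field_simp
      ring
    rw [he]
    gcongr

/-- The intensity parameter: `ε₂` if `α ≤ 1` and `ε₁` if `α > 1`. -/
def deltaParam (ε₁ ε₂ α : ℝ) : ℝ := if α ≤ 1 then ε₂ else ε₁

/-- `1 - e^{-m} (1 + m + m² / 2)` with `m = δ A²`: the probability that a Poisson variable
of mean `δ A²` is at least three. -/
def denseProb (δ A : ℝ) : ℝ :=
  1 - Real.exp (-(δ * A ^ 2)) * (1 + δ * A ^ 2 + δ ^ 2 * A ^ 4 / 2)

theorem denseProb_pos {δ A : ℝ} (hδ : 0 < δ) (hA : 0 < A) : 0 < denseProb δ A := by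
  have hm : 0 < δ * A ^ 2 := by positivity
  have h4 := Real.sum_le_exp_of_nonneg hm.le 4
  simp only [Finset.sum_range_succ, Finset.sum_range_zero, Nat.factorial] at h4
  have h3 : 0 < (δ * A ^ 2) ^ 3 := by positivity
  have hlt : 1 + δ * A ^ 2 + δ ^ 2 * A ^ 4 / 2 < Real.exp (δ * A ^ 2) := by
    norm_num at h4
    nlinarith
  have he := Real.exp_pos (-(δ * A ^ 2))
  have hmul : Real.exp (-(δ * A ^ 2)) * Real.exp (δ * A ^ 2) = 1 := by
    rw [← Real.exp_add]; simp
  unfold denseProb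
  nlinarith

theorem denseProb_lt_one {δ A : ℝ} (hδ : 0 < δ) : denseProb δ A < 1 := by
  have : 0 < Real.exp (-(δ * A ^ 2)) * (1 + δ * A ^ 2 + δ ^ 2 * A ^ 4 / 2) := by positivity
  unfold denseProb
  linarith

/-- The constant `C₁(A)` of the lower bounds. -/
def lowerConst (c₁ ε₁ ε₂ α A : ℝ) : ℝ :=
  (c₁ * A) ^ α / A ^ 2 * (1 - Real.exp (-(ε₁ * A ^ 2))) * Real.exp (-(8 * ε₂ * A ^ 2))

/-- The constant `C₂(A)` of the upper bounds. -/
def upperConst (c₂ ε₁ ε₂ α A : ℝ) : ℝ :=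
  (2 * c₂ * A) ^ α *
    (1 + 1 / A ^ 2 * (geomMoment (denseProb (deltaParam ε₁ ε₂ α) A) α
      + geomMoment (1 - denseProb (deltaParam ε₁ ε₂ α) A) α))

end

/-! Both bounds compare the tour with a grid of `M ^ 2` squares, count a local quantity on the grid,
and use McDiarmid's inequality to show that the quantity stays near its mean.

Lower bound. With squares of side about `A / √n`, call an occupied square isolated if its at most
eight neighbours are empty. Once there are two isolated squares, a tour must leave each of them, and
the edge by which it leaves ends outside the 3 × 3 block, so its length is at least `1 / M`. Edges
leaving different squares are different, so the weight is at least the number of isolated squares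
times `(c₁ / M) ^ α` (`card_isolatedCells_mul_le_tspWeight`). Their mean number is about `n / A ^ 2`
times the exponential factors of `lowerConst`. Moving one node changes the number by at most 18.

Upper bound. For `M` even there is a closed snake through all squares by unit steps. The nodes are
visited in the order of their squares; if two consecutive nodes are `g` steps apart on the snake,
their distance is at most `(g + 2) / M`, and the gaps add up to `M ^ 2` (`exists_perm_gaps`). If `α
≤ 1`, concavity of `t ^ α` and the choice `M ≈ √n` give a deterministic bound with constant `(3 *
c₂) ^ α ≤ upperConst`. If `α > 1`, again with side about `A / √n`, the power `g ^ α` is written as a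
double sum of its nonnegative second differences, each charged to a run of empty squares. The mean
of the resulting `gapSum` is then a power series in the probability that one square is empty, and
summation by parts turns it into `p * geomMoment p α`. Cutting the runs off at a small power of `n`
keeps the bounded differences small; a union bound shows that longer empty runs are
superpolynomially unlikely.

Moments. The lower bound integrates the lower tail event. For the upper bound, the crude estimate
`TSP ≤ n (2 c₂) ^ α` on the exceptional event is harmless, because that event has probability below
any prescribed power of `n`.

The law and the edge weight are quantified inside the eventual statements, so the threshold for `n`
depends only on the constants. -/

/-! ### McDiarmid's bounded difference inequality on product spaces. -/

section BoundedDifferences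

open scoped NNReal

variable {S : Type*} [MeasurableSpace S] (μ : Measure S) [IsProbabilityMeasure μ]

theorem integral_pi_succ_eq {n : ℕ} (F : (Fin (n + 1) → S) → ℝ) :
    ∫ x, F x ∂(Measure.pi fun _ => μ)
      = ∫ p : S × (Fin n → S), F (Fin.cons p.1 p.2) ∂(μ.prod (Measure.pi fun _ => μ)) := by
  rw [← ((measurePreserving_piFinSuccAbove (fun _ : Fin (n + 1) => μ) 0).symm).integral_comp']
  simp_rw [MeasurableEquiv.piFinSuccAbove_symm_apply, Fin.insertNthEquiv, Fin.insertNth_zero,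
    Equiv.coe_fn_mk]
  rfl

/-- **McDiarmid's inequality**, in the form of a bound on the moment generating function. -/
theorem hasSubgaussianMGF_of_bounded_differences (c : ℝ≥0) {B : ℝ} :
    ∀ {n : ℕ} {F : (Fin n → S) → ℝ}, Measurable F → (∀ x, |F x| ≤ B) →
      (∀ x i s, |F (Function.update x i s) - F x| ≤ c) →
      HasSubgaussianMGF (fun x => F x - ∫ y, F y ∂(Measure.pi fun _ => μ)) (n * c ^ 2)
        (Measure.pi fun _ => μ) := by
  intro n
  induction n with
  | zero =>
    intro F hF hB hc
    have : (fun x => F x - ∫ y, F y ∂(Measure.pi fun _ : Fin 0 => μ)) = fun _ => 0 := by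
      ext x
      have h1 : ∀ y, F y = F x := fun y => by rw [Subsingleton.elim y x]
      simp [h1]
    rw [this]
    simp
  | succ n ih =>
    intro F hF hB hc
    have hcons : Measurable fun p : S × (Fin n → S) =>
        (Fin.cons p.1 p.2 : Fin (n + 1) → S) := by
      refine measurable_pi_iff.2 fun i => ?_
      refine Fin.cases ?_ (fun j => ?_) i
      · simpa using measurable_fst
      · simp only [Fin.cons_succ]
        exact (measurable_pi_apply j).comp measurable_snd
    set Q : Measure (Fin n → S) := Measure.pi fun _ => μ with hQ
    -- Averaging out the first coordinate keeps the bounded differences, so the induction hypothesis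
    -- applies to `G`, while `F - G` is centred on each slice.
    set G : (Fin n → S) → ℝ := fun y => ∫ s, F (Fin.cons s y) ∂μ with hG
    have hFc : Measurable fun p : S × (Fin n → S) => F (Fin.cons p.1 p.2) := hF.comp hcons
    have hGm : Measurable G :=
      (StronglyMeasurable.integral_prod_left' (μ := μ) hFc.stronglyMeasurable).measurable
    have hFs : ∀ y, Measurable fun s => F (Fin.cons s y) := fun y =>
      hFc.comp (measurable_id.prodMk measurable_const)
    have hFi : ∀ y, Integrable (fun s => F (Fin.cons s y)) μ := fun y =>
      Integrable.of_bound (hFs y).aestronglyMeasurable B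
        (Filter.Eventually.of_forall fun s => by rw [Real.norm_eq_abs]; exact hB _)
    have hGB : ∀ y, |G y| ≤ B := fun y => by
      have := norm_integral_le_of_norm_le_const (μ := μ) (f := fun s => F (Fin.cons s y))
        (C := B) (Filter.Eventually.of_forall fun s => by rw [Real.norm_eq_abs]; exact hB _)
      simpa using this
    have hGc : ∀ y i s, |G (Function.update y i s) - G y| ≤ c := fun y i s => by
      rw [hG]
      dsimp only
      rw [← integral_sub (hFi _) (hFi _)]
      have := norm_integral_le_of_norm_le_const (μ := μ)
        (f := fun t => F (Fin.cons t (Function.update y i s)) - F (Fin.cons t y))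
        (C := c) (Filter.Eventually.of_forall fun t => by
          rw [Real.norm_eq_abs, Fin.cons_update]; exact hc _ _ _)
      simpa using this
    have hI := ih hGm hGB hGc
    have hEFI : Integrable (fun p : S × (Fin n → S) => F (Fin.cons p.1 p.2)) (μ.prod Q) :=
      Integrable.of_bound hFc.aestronglyMeasurable B
        (Filter.Eventually.of_forall fun s => by rw [Real.norm_eq_abs]; exact hB _)
    have hEF : ∫ y, F y ∂(Measure.pi fun _ => μ) = ∫ y, G y ∂Q := by
      rw [integral_pi_succ_eq, integral_prod_symm _ hEFI]
    rw [hEF]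
    set m := ∫ y, G y ∂Q
    -- A slice stays within `c` of its value at `s₀`, hence in an interval of length `2 * c`;
    -- Hoeffding's lemma gives the parameter `(2 * c / 2) ^ 2 = c ^ 2`.
    have hsub : ∀ y, HasSubgaussianMGF (fun s => F (Fin.cons s y) - G y) (c ^ 2) μ := by
      intro y
      obtain ⟨s₀⟩ : Nonempty S := nonempty_of_isProbabilityMeasure μ
      have h1 := hasSubgaussianMGF_of_mem_Icc (μ := μ) (X := fun s => F (Fin.cons s y))
        (a := F (Fin.cons s₀ y) - c) (b := F (Fin.cons s₀ y) + c) (hFs y).aemeasurable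
        (Filter.Eventually.of_forall fun s => by
          have := hc (Fin.cons s₀ y) 0 s
          rw [Fin.update_cons_zero, abs_le] at this
          constructor <;> linarith [this.1, this.2])
      convert h1 using 1
      have : F (Fin.cons s₀ y) + c - (F (Fin.cons s₀ y) - c) = 2 * (c : ℝ) := by ring
      rw [this]
      ext
      simp
    have hbound : ∀ t x, Real.exp (t * (F x - m)) ≤ Real.exp (|t| * (B + |m|)) := fun t x => by
      refine Real.exp_le_exp.2 ((le_abs_self _).trans ?_)
      rw [abs_mul]
      exact mul_le_mul_of_nonneg_left ((abs_sub _ _).trans (by linarith [hB x])) (abs_nonneg _)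
    refine ⟨fun t => ?_, fun t => ?_⟩
    · refine Integrable.of_bound (by fun_prop) (Real.exp (|t| * (B + |m|)))
        (Filter.Eventually.of_forall fun x => ?_)
      rw [Real.norm_eq_abs, abs_of_pos (Real.exp_pos _)]
      exact hbound t x
    -- The exponential factors as `exp (t (G - m)) * exp (t (F - G))`; the inner integral of the
    -- second factor is bounded uniformly in `y`, and the first is left to the induction hypothesis.
    · rw [mgf, integral_pi_succ_eq, integral_prod_symm]
      · calc ∫ y, ∫ s, Real.exp (t * (F (Fin.cons s y) - m)) ∂μ ∂Q
            = ∫ y, Real.exp (t * (G y - m)) * mgf (fun s => F (Fin.cons s y) - G y) μ t ∂Q := by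
              refine integral_congr_ae (Filter.Eventually.of_forall fun y => ?_)
              dsimp only
              rw [mgf, ← integral_const_mul]
              refine integral_congr_ae (Filter.Eventually.of_forall fun s => ?_)
              dsimp only
              rw [← Real.exp_add]
              ring_nf
          _ ≤ ∫ y, Real.exp (t * (G y - m)) * Real.exp (c ^ 2 * t ^ 2 / 2) ∂Q := by
              refine integral_mono_of_nonneg (Filter.Eventually.of_forall fun y => ?_) ?_
                (Filter.Eventually.of_forall fun y => ?_)
              · exact mul_nonneg (Real.exp_pos _).le mgf_nonneg
              · exact (hI.integrable_exp_mul t).mul_const _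
              · refine mul_le_mul_of_nonneg_left ?_ (Real.exp_pos _).le
                simpa using (hsub y).mgf_le t
          _ = mgf (fun y => G y - m) Q t * Real.exp (c ^ 2 * t ^ 2 / 2) := by
              rw [integral_mul_const, mgf]
          _ ≤ Real.exp ((n * c ^ 2 : ℝ≥0) * t ^ 2 / 2) * Real.exp (c ^ 2 * t ^ 2 / 2) :=
              mul_le_mul_of_nonneg_right (hI.mgf_le t) (Real.exp_pos _).le
          _ = _ := by
              rw [← Real.exp_add]
              push_cast
              ring_nf
      · refine Integrable.of_bound
          (((hFc.sub_const m).const_mul t).exp.aestronglyMeasurable) (Real.exp (|t| * (B + |m|)))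
          (Filter.Eventually.of_forall fun x => ?_)
        rw [Real.norm_eq_abs, abs_of_pos (Real.exp_pos _)]
        exact hbound t _

/-- **McDiarmid's inequality**, upper tail. -/
theorem measure_ge_le_of_bounded_differences {n : ℕ} {F : (Fin n → S) → ℝ} (hF : Measurable F)
    {B : ℝ} (hB : ∀ x, |F x| ≤ B) {c : ℝ} (hc0 : 0 ≤ c)
    (hc : ∀ x i s, |F (Function.update x i s) - F x| ≤ c) {t : ℝ} (ht : 0 ≤ t) :
    (Measure.pi fun _ : Fin n => μ).real
        {x | (∫ y, F y ∂(Measure.pi fun _ => μ)) + t ≤ F x}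
      ≤ Real.exp (-t ^ 2 / (2 * (n * c ^ 2))) := by
  have h := (hasSubgaussianMGF_of_bounded_differences μ ⟨c, hc0⟩ hF hB hc).measure_ge_le ht
  simp only [NNReal.coe_mul, NNReal.coe_natCast] at h
  refine le_trans (le_of_eq ?_) h
  congr 1
  ext x
  simp only [Set.mem_ofPred_eq]
  constructor <;> intro h <;> linarith

/-- **McDiarmid's inequality**, lower tail. -/
theorem measure_le_le_of_bounded_differences {n : ℕ} {F : (Fin n → S) → ℝ} (hF : Measurable F)
    {B : ℝ} (hB : ∀ x, |F x| ≤ B) {c : ℝ} (hc0 : 0 ≤ c)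
    (hc : ∀ x i s, |F (Function.update x i s) - F x| ≤ c) {t : ℝ} (ht : 0 ≤ t) :
    (Measure.pi fun _ : Fin n => μ).real
        {x | F x ≤ (∫ y, F y ∂(Measure.pi fun _ => μ)) - t}
      ≤ Real.exp (-t ^ 2 / (2 * (n * c ^ 2))) := by
  have h := measure_ge_le_of_bounded_differences μ hF.neg (B := B) (by simpa using hB) hc0
    (fun x i s => by
      rw [Pi.neg_apply, Pi.neg_apply, neg_sub_neg, abs_sub_comm]
      exact hc x i s) ht
  refine le_trans (le_of_eq ?_) h
  congr 1
  ext x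
  simp only [Set.mem_ofPred_eq, Pi.neg_apply, integral_neg]
  constructor <;> intro h <;> linarith

end BoundedDifferences

/-! ### The subdivision of the unit square into `M ^ 2` squares. -/

section Grid

/-- The index of the interval of length `1 / M` of the subdivision of `[0, 1]` containing `t`. -/
noncomputable def gridCoord (M : ℕ) (t : ℝ) : ℕ := min ⌊M * t⌋₊ (M - 1)

/-- The index of the square of side `1 / M` of the subdivision of the unit square
containing `x`. -/
noncomputable def gridCell (M : ℕ) (x : UnitSquare) : ℕ × ℕ := (gridCoord M (x.1 0), gridCoord M (x.1 1))

theorem gridCoord_lt {M : ℕ} (hM : 0 < M) (t : ℝ) : gridCoord M t < M := by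
  unfold gridCoord; omega

theorem gridCoord_le {M : ℕ} {t : ℝ} (ht : 0 ≤ t) : (gridCoord M t : ℝ) ≤ M * t := by
  refine le_trans ?_ (Nat.floor_le (by positivity : 0 ≤ (M : ℝ) * t))
  exact_mod_cast min_le_left _ _

/-- When the cap `M - 1` is attained the claim becomes `M * t ≤ M`, which is where `t ≤ 1` enters.
-/
theorem le_gridCoord_add_one {M : ℕ} (hM : 0 < M) {t : ℝ} (ht : t ≤ 1) :
    M * t ≤ gridCoord M t + 1 := by
  unfold gridCoord
  rcases le_total ⌊(M : ℝ) * t⌋₊ (M - 1) with h | h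
  · rw [min_eq_left h]
    exact (Nat.lt_floor_add_one _).le
  · rw [min_eq_right h, Nat.cast_sub (by omega)]
    have : (0 : ℝ) < M := by exact_mod_cast hM
    push_cast
    nlinarith

theorem measurable_gridCoord (M : ℕ) : Measurable (gridCoord M) :=
  (Nat.measurable_floor.comp (measurable_const.mul measurable_id)).min measurable_const

theorem measurable_coord (i : Fin 2) : Measurable fun x : UnitSquare => x.1 i := by
  fun_prop

theorem measurable_gridCell (M : ℕ) : Measurable (gridCell M) :=
  ((measurable_gridCoord M).comp (measurable_coord 0)).prodMk
    ((measurable_gridCoord M).comp (measurable_coord 1))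

/-- The index set of the squares of side `1 / M` of the subdivision. -/
def gridCells (M : ℕ) : Finset (ℕ × ℕ) := Finset.range M ×ˢ Finset.range M

theorem card_gridCells (M : ℕ) : (gridCells M).card = M ^ 2 := by
  simp [gridCells, sq]

theorem gridCell_mem {M : ℕ} (hM : 0 < M) (x : UnitSquare) : gridCell M x ∈ gridCells M := by
  simp [gridCells, gridCell, gridCoord_lt hM]

theorem dist_unitSquare (x y : UnitSquare) :
    dist x y = √((x.1 0 - y.1 0) ^ 2 + (x.1 1 - y.1 1) ^ 2) := by
  rw [Subtype.dist_eq, EuclideanSpace.dist_eq, Fin.sum_univ_two, Real.dist_eq, Real.dist_eq,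
    sq_abs, sq_abs]

theorem dist_le_abs_add_abs (x y : UnitSquare) :
    dist x y ≤ |x.1 0 - y.1 0| + |x.1 1 - y.1 1| := by
  rw [dist_unitSquare]
  refine Real.sqrt_le_iff.2 ⟨by positivity, ?_⟩
  nlinarith [sq_abs (x.1 0 - y.1 0), sq_abs (x.1 1 - y.1 1),
    mul_nonneg (abs_nonneg (x.1 0 - y.1 0)) (abs_nonneg (x.1 1 - y.1 1))]

theorem dist_unitSquare_le_two (x y : UnitSquare) : dist x y ≤ 2 := by
  refine (dist_le_abs_add_abs x y).trans ?_
  have h : ∀ i, |x.1 i - y.1 i| ≤ 1 := fun i => by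
    have h1 := x.2 i
    have h2 := y.2 i
    rw [abs_le]
    constructor <;> linarith [h1.1, h1.2, h2.1, h2.2]
  linarith [h 0, h 1]

theorem abs_sub_le_dist (x y : UnitSquare) (i : Fin 2) : |x.1 i - y.1 i| ≤ dist x y := by
  rw [dist_unitSquare]
  refine Real.le_sqrt_of_sq_le ?_
  rw [sq_abs]
  fin_cases i <;> simp <;> positivity

theorem abs_sub_le_of_gridCoord {M : ℕ} (hM : 0 < M) {s t : ℝ} (hs : s ∈ Set.Icc (0 : ℝ) 1)
    (ht : t ∈ Set.Icc (0 : ℝ) 1) :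
    |s - t| ≤ (|(gridCoord M s : ℝ) - gridCoord M t| + 1) / M := by
  have hM' : (0 : ℝ) < M := by exact_mod_cast hM
  have hmul : |s - t| * M = |(s - t) * M| := by rw [abs_mul, abs_of_pos hM']
  rw [le_div_iff₀ hM', hmul]
  have h1 := gridCoord_le (M := M) hs.1
  have h2 := gridCoord_le (M := M) ht.1
  have h3 := le_gridCoord_add_one hM hs.2
  have h4 := le_gridCoord_add_one hM ht.2
  rw [abs_le]
  have h5 := le_abs_self ((gridCoord M s : ℝ) - gridCoord M t)
  have h6 := neg_abs_le ((gridCoord M s : ℝ) - gridCoord M t)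
  constructor <;> nlinarith

theorem le_abs_sub_of_gridCoord {M : ℕ} (hM : 0 < M) {s t : ℝ} (hs : s ∈ Set.Icc (0 : ℝ) 1)
    (ht : t ∈ Set.Icc (0 : ℝ) 1) (h : gridCoord M s + 1 < gridCoord M t) :
    1 / M ≤ |s - t| := by
  have hM' : (0 : ℝ) < M := by exact_mod_cast hM
  have h2 := gridCoord_le (M := M) ht.1
  have h3 := le_gridCoord_add_one hM hs.2
  have h' : (gridCoord M s : ℝ) + 2 ≤ gridCoord M t := by exact_mod_cast h
  rw [div_le_iff₀ hM']
  have := neg_le_abs (s - t)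
  nlinarith

theorem dist_le_of_gridCell {M : ℕ} (hM : 0 < M) (x y : UnitSquare) :
    dist x y ≤ (|((gridCell M x).1 : ℝ) - (gridCell M y).1|
      + |((gridCell M x).2 : ℝ) - (gridCell M y).2| + 2) / M := by
  refine (dist_le_abs_add_abs x y).trans ?_
  have h0 := abs_sub_le_of_gridCoord hM (x.2 0) (y.2 0)
  have h1 := abs_sub_le_of_gridCoord hM (x.2 1) (y.2 1)
  refine (add_le_add h0 h1).trans (le_of_eq ?_)
  simp only [gridCell]
  ring

/-- Two squares of the subdivision are near if they are equal or touch each other. -/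
def NearCell (p q : ℕ × ℕ) : Prop :=
  p.1 ≤ q.1 + 1 ∧ q.1 ≤ p.1 + 1 ∧ p.2 ≤ q.2 + 1 ∧ q.2 ≤ p.2 + 1

instance : DecidableRel NearCell := fun p q => by unfold NearCell; infer_instance

theorem NearCell.symm {p q : ℕ × ℕ} (h : NearCell p q) : NearCell q p := by
  unfold NearCell at *; tauto

/-- Some coordinate of the indices differs by at least two, so a full strip of width `1 / M`
separates the points. -/
theorem le_dist_of_not_nearCell {M : ℕ} (hM : 0 < M) {x y : UnitSquare}
    (h : ¬ NearCell (gridCell M x) (gridCell M y)) : 1 / M ≤ dist x y := by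
  unfold NearCell at h
  simp only [gridCell] at h
  have key : ∀ i, (gridCoord M (x.1 i) + 1 < gridCoord M (y.1 i) ∨
      gridCoord M (y.1 i) + 1 < gridCoord M (x.1 i)) → 1 / M ≤ dist x y := by
    rintro i (hi | hi)
    · exact (le_abs_sub_of_gridCoord hM (x.2 i) (y.2 i) hi).trans (abs_sub_le_dist x y i)
    · rw [dist_comm]
      exact (le_abs_sub_of_gridCoord hM (y.2 i) (x.2 i) hi).trans (abs_sub_le_dist y x i)
  by_cases h0 : gridCoord M (x.1 0) + 1 < gridCoord M (y.1 0) ∨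
      gridCoord M (y.1 0) + 1 < gridCoord M (x.1 0)
  · exact key 0 h0
  · exact key 1 (by omega)

/-- The near squares lie in a 3 × 3 block; truncated subtraction only shrinks it at the border. -/
theorem card_filter_nearCell_le (M : ℕ) (q : ℕ × ℕ) :
    ((gridCells M).filter fun p => NearCell p q).card ≤ 9 := by
  have hsub : ((gridCells M).filter fun p => NearCell p q)
      ⊆ Finset.Icc (q.1 - 1) (q.1 + 1) ×ˢ Finset.Icc (q.2 - 1) (q.2 + 1) := by
    intro p hp
    have := (Finset.mem_filter.1 hp).2
    unfold NearCell at this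
    simp only [Finset.mem_product, Finset.mem_Icc]
    omega
  refine (Finset.card_le_card hsub).trans ?_
  rw [Finset.card_product, Nat.card_Icc, Nat.card_Icc]
  exact Nat.mul_le_mul (by omega : _ ≤ 3) (by omega : _ ≤ 3)

/-- The last interval of the subdivision is closed, the others are half open. Squeezing between
`Set.Ico` and `Set.Icc` with the same end points treats both kinds at once. -/
theorem volume_gridCoord_eq {M : ℕ} {c : ℕ} (hc : c < M) :
    volume {t : ℝ | t ∈ Set.Icc (0 : ℝ) 1 ∧ gridCoord M t = c} = ENNReal.ofReal (1 / M) := by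
  have hM : 0 < M := by omega
  have hM' : (0 : ℝ) < M := by exact_mod_cast hM
  refine le_antisymm ?_ ?_
  · refine (measure_mono (t := Set.Icc ((c : ℝ) / M) ((c + 1) / M)) ?_).trans ?_
    · rintro t ⟨ht, rfl⟩
      rw [Set.mem_Icc, div_le_iff₀ hM', le_div_iff₀ hM', mul_comm t]
      exact ⟨gridCoord_le ht.1, le_gridCoord_add_one hM ht.2⟩
    · rw [Real.volume_Icc]
      refine ENNReal.ofReal_le_ofReal (le_of_eq ?_)
      ring
  · refine le_trans ?_ (measure_mono (s := Set.Ico ((c : ℝ) / M) ((c + 1) / M)) ?_)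
    · rw [Real.volume_Ico]
      refine ENNReal.ofReal_le_ofReal (le_of_eq ?_)
      ring
    · rintro t ⟨h1, h2⟩
      rw [div_le_iff₀ hM'] at h1
      rw [lt_div_iff₀ hM'] at h2
      have hc' : (c : ℝ) + 1 ≤ M := by exact_mod_cast hc
      have ht0 : 0 ≤ t := by
        by_contra! h
        have : (0 : ℝ) ≤ c := c.cast_nonneg
        nlinarith
      refine ⟨⟨ht0, by nlinarith⟩, ?_⟩
      have : ⌊(M : ℝ) * t⌋₊ = c := by
        rw [Nat.floor_eq_iff (by positivity)]
        constructor <;> linarith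
      rw [gridCoord, this]
      omega

theorem measurableSet_unitSquare : MeasurableSet unitSquare := by
  have : unitSquare = ⋂ i, {p : EuclideanSpace ℝ (Fin 2) | p i ∈ Set.Icc (0 : ℝ) 1} := by
    ext p; simp [unitSquare]
  rw [this]
  refine MeasurableSet.iInter fun i => ?_
  have : Measurable fun p : EuclideanSpace ℝ (Fin 2) => p i := by fun_prop
  exact this measurableSet_Icc

theorem squareVolume_gridCell_eq {M : ℕ} {q : ℕ × ℕ} (hq : q ∈ gridCells M) :
    squareVolume (gridCell M ⁻¹' {q}) = ENNReal.ofReal (1 / (M : ℝ) ^ 2) := by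
  obtain ⟨h1, h2⟩ : q.1 < M ∧ q.2 < M := by simpa [gridCells] using hq
  let J : Fin 2 → Set ℝ := ![{t : ℝ | t ∈ Set.Icc (0 : ℝ) 1 ∧ gridCoord M t = q.1},
    {t : ℝ | t ∈ Set.Icc (0 : ℝ) 1 ∧ gridCoord M t = q.2}]
  have himg : Subtype.val '' (gridCell M ⁻¹' {q} : Set UnitSquare)
      = (WithLp.ofLp : EuclideanSpace ℝ (Fin 2) → Fin 2 → ℝ) ⁻¹' Set.pi Set.univ J := by
    ext p
    constructor
    · rintro ⟨x, hx, rfl⟩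
      have hx' : gridCell M x = q := hx
      refine fun i _ => ?_
      fin_cases i
      · exact ⟨x.2 0, congrArg Prod.fst hx'⟩
      · exact ⟨x.2 1, congrArg Prod.snd hx'⟩
    · intro hp
      have h0 : p 0 ∈ Set.Icc (0 : ℝ) 1 ∧ gridCoord M (p 0) = q.1 := hp 0 (Set.mem_univ _)
      have h1 : p 1 ∈ Set.Icc (0 : ℝ) 1 ∧ gridCoord M (p 1) = q.2 := hp 1 (Set.mem_univ _)
      exact ⟨⟨p, Fin.forall_fin_two.2 ⟨h0.1, h1.1⟩⟩, Prod.ext h0.2 h1.2, rfl⟩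
  have hJ : ∀ i, MeasurableSet (J i) := by
    have : ∀ c, MeasurableSet {t : ℝ | t ∈ Set.Icc (0 : ℝ) 1 ∧ gridCoord M t = c} := fun c =>
      measurableSet_Icc.inter (measurable_gridCoord M (measurableSet_singleton c))
    exact Fin.forall_fin_two.2 ⟨this _, this _⟩
  rw [squareVolume, Measure.comap_apply₀ _ _ Subtype.val_injective
    (fun s hs => (measurableSet_unitSquare.subtype_image hs).nullMeasurableSet)
    (measurable_gridCell M (measurableSet_singleton q)).nullMeasurableSet, himg,
    (PiLp.volume_preserving_ofLp (Fin 2)).measure_preimage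
      (MeasurableSet.univ_pi hJ).nullMeasurableSet, volume_pi_pi, Fin.prod_univ_two]
  simp only [J, Matrix.cons_val_zero, Matrix.cons_val_one]
  rw [volume_gridCoord_eq h1, volume_gridCoord_eq h2, ← ENNReal.ofReal_mul (by positivity)]
  congr 1
  field_simp

theorem squareVolume_gridCell_preimage {M : ℕ} {T : Finset (ℕ × ℕ)} (hT : T ⊆ gridCells M) :
    squareVolume (gridCell M ⁻¹' T) = ENNReal.ofReal (T.card / (M : ℝ) ^ 2) := by
  have : gridCell M ⁻¹' (T : Set (ℕ × ℕ)) = ⋃ q ∈ T, gridCell M ⁻¹' {q} := by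
    ext x; simp
  rw [this, measure_biUnion_finset]
  · rw [Finset.sum_congr rfl fun q hq => squareVolume_gridCell_eq (hT hq), Finset.sum_const,
      nsmul_eq_mul, ← ENNReal.ofReal_natCast, ← ENNReal.ofReal_mul (by positivity)]
    congr 1
    ring
  · intro p _ q _ hpq
    refine Disjoint.preimage _ ?_
    simpa using hpq
  · exact fun q _ => measurable_gridCell M (measurableSet_singleton q)

/-- `μ` is a probability measure on the unit square with a density between `ε₁` and `ε₂`. -/
structure IsBoundedLaw (ε₁ ε₂ : ℝ) (μ : Measure UnitSquare) : Prop where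
  isProbabilityMeasure : IsProbabilityMeasure μ
  lower : ∀ B, MeasurableSet B → ENNReal.ofReal ε₁ * squareVolume B ≤ μ B
  upper : ∀ B, MeasurableSet B → μ B ≤ ENNReal.ofReal ε₂ * squareVolume B

variable {ε₁ ε₂ : ℝ} {μ : Measure UnitSquare}

theorem IsBoundedLaw.le_gridCell (hμ : IsBoundedLaw ε₁ ε₂ μ) (hε : 0 ≤ ε₁) {M : ℕ}
    {T : Finset (ℕ × ℕ)} (hT : T ⊆ gridCells M) :
    ε₁ * (T.card / (M : ℝ) ^ 2) ≤ μ.real (gridCell M ⁻¹' T) := by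
  have := hμ.isProbabilityMeasure
  have h := hμ.lower (gridCell M ⁻¹' T) (measurable_gridCell M T.measurableSet)
  rw [squareVolume_gridCell_preimage hT, ← ENNReal.ofReal_mul hε] at h
  exact (ENNReal.ofReal_le_iff_le_toReal (measure_ne_top _ _)).1 h

theorem IsBoundedLaw.gridCell_le (hμ : IsBoundedLaw ε₁ ε₂ μ) (hε : 0 ≤ ε₂) {M : ℕ}
    {T : Finset (ℕ × ℕ)} (hT : T ⊆ gridCells M) :
    μ.real (gridCell M ⁻¹' T) ≤ ε₂ * (T.card / (M : ℝ) ^ 2) := by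
  have h := hμ.upper (gridCell M ⁻¹' T) (measurable_gridCell M T.measurableSet)
  rw [squareVolume_gridCell_preimage hT, ← ENNReal.ofReal_mul hε] at h
  exact ENNReal.toReal_le_of_le_ofReal (by positivity) h

theorem pi_real_forall_notMem [IsProbabilityMeasure μ] (n M : ℕ) (T : Finset (ℕ × ℕ)) :
    (Measure.pi fun _ : Fin n => μ).real {x | ∀ i, gridCell M (x i) ∉ T}
      = (1 - μ.real (gridCell M ⁻¹' T)) ^ n := by
  have : {x : Fin n → UnitSquare | ∀ i, gridCell M (x i) ∉ T}
      = Set.pi Set.univ fun _ => (gridCell M ⁻¹' T)ᶜ := by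
    ext x; simp
  rw [this, measureReal_def, Measure.pi_pi, Finset.prod_const, ENNReal.toReal_pow,
    ← measureReal_def, probReal_compl_eq_one_sub (measurable_gridCell M T.measurableSet)]
  simp

end Grid

/-! ### Isolated squares: the lower bound for the tour, mean and concentration of their number. -/

section IsolatedCells

variable {n : ℕ}

/-- The square `q` contains a node and the (at most eight) squares touching it contain none. -/
def IsIsolatedCell (M : ℕ) (x : Fin n → UnitSquare) (q : ℕ × ℕ) : Prop :=
  (∃ i, gridCell M (x i) = q) ∧ ∀ i, gridCell M (x i) ≠ q → ¬ NearCell (gridCell M (x i)) q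

open Classical in
/-- The squares of the subdivision that contain a node and have no node next to them. -/
noncomputable def isolatedCells (M : ℕ) (x : Fin n → UnitSquare) : Finset (ℕ × ℕ) :=
  (gridCells M).filter (IsIsolatedCell M x)

/-- Isolation of `q` depends only on the nodes in the 3 × 3 block around `q`, and the moved node is
outside this block before and after. -/
theorem isIsolatedCell_update {M : ℕ} {x : Fin n → UnitSquare} {i : Fin n} {s : UnitSquare}
    {q : ℕ × ℕ} (h0 : ¬ NearCell (gridCell M (x i)) q) (h1 : ¬ NearCell (gridCell M s) q) :
    IsIsolatedCell M (Function.update x i s) q ↔ IsIsolatedCell M x q := by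
  have hrefl : NearCell q q := by unfold NearCell; omega
  have h0' : gridCell M (x i) ≠ q := fun h => h0 (h ▸ hrefl)
  have h1' : gridCell M s ≠ q := fun h => h1 (h ▸ hrefl)
  constructor
  · rintro ⟨⟨j, hj⟩, h⟩
    refine ⟨⟨j, ?_⟩, fun k hk => ?_⟩
    · by_cases hji : j = i
      · subst hji
        simp [h1'] at hj
      · simpa [hji] using hj
    · by_cases hki : k = i
      · subst hki
        exact h0
      · simpa [hki] using h k (by simpa [hki] using hk)
  · rintro ⟨⟨j, hj⟩, h⟩
    refine ⟨⟨j, ?_⟩, fun k hk => ?_⟩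
    · by_cases hji : j = i
      · subst hji
        exact absurd hj h0'
      · simpa [hji] using hj
    · by_cases hki : k = i
      · subst hki
        simpa using h1
      · simpa [hki] using h k (by simpa [hki] using hk)

/-- Only squares near the old or the new position can change status: at most `9 + 9`. -/
theorem abs_card_isolatedCells_update_sub_le (M : ℕ) (x : Fin n → UnitSquare) (i : Fin n)
    (s : UnitSquare) :
    |((isolatedCells M (Function.update x i s)).card : ℝ) - (isolatedCells M x).card| ≤ 18 := by
  classical
  set U := ((gridCells M).filter fun p => NearCell p (gridCell M (x i)))
    ∪ (gridCells M).filter fun p => NearCell p (gridCell M s) with hU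
  have hUc : U.card ≤ 18 := (Finset.card_union_le _ _).trans
    (add_le_add (card_filter_nearCell_le M _) (card_filter_nearCell_le M _))
  have key : ∀ q ∈ gridCells M, q ∉ U →
      (IsIsolatedCell M (Function.update x i s) q ↔ IsIsolatedCell M x q) := by
    intro q hq hqU
    simp only [hU, Finset.mem_union, Finset.mem_filter, not_or, not_and] at hqU
    exact isIsolatedCell_update (fun h => hqU.1 hq h.symm) (fun h => hqU.2 hq h.symm)
  have h1 : isolatedCells M (Function.update x i s) ⊆ isolatedCells M x ∪ U := by
    intro q hq
    by_cases hqU : q ∈ U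
    · exact Finset.mem_union_right _ hqU
    · rw [isolatedCells, Finset.mem_filter] at hq
      refine Finset.mem_union_left _ (Finset.mem_filter.2 ⟨hq.1, (key q hq.1 hqU).1 hq.2⟩)
  have h2 : isolatedCells M x ⊆ isolatedCells M (Function.update x i s) ∪ U := by
    intro q hq
    by_cases hqU : q ∈ U
    · exact Finset.mem_union_right _ hqU
    · rw [isolatedCells, Finset.mem_filter] at hq
      refine Finset.mem_union_left _ (Finset.mem_filter.2 ⟨hq.1, (key q hq.1 hqU).2 hq.2⟩)
  have h1' := (Finset.card_le_card h1).trans (Finset.card_union_le _ _)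
  have h2' := (Finset.card_le_card h2).trans (Finset.card_union_le _ _)
  have h1'' : ((isolatedCells M (Function.update x i s)).card : ℝ)
      ≤ (isolatedCells M x).card + 18 := by exact_mod_cast h1'.trans (by omega)
  have h2'' : ((isolatedCells M x).card : ℝ)
      ≤ (isolatedCells M (Function.update x i s)).card + 18 := by
    exact_mod_cast h2'.trans (by omega)
  rw [abs_le]
  constructor <;> linarith

/-- Otherwise following the cycle from the node `i` would never leave `q`, although it reaches `k`.
-/
theorem exists_exit_edge {M : ℕ} {x : Fin n → UnitSquare} (σ : Equiv.Perm (Fin n))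
    {q : ℕ × ℕ} {i k : Fin n} (hi : gridCell M (x i) = q) (hk : gridCell M (x k) ≠ q) :
    ∃ j, gridCell M (x (σ j)) = q ∧ gridCell M (x (σ (finRotate n j))) ≠ q := by
  by_contra! hcon
  obtain _ | n := n
  · exact i.elim0
  have key : ∀ m : ℕ, gridCell M (x (σ (σ.symm i + Fin.ofNat (n + 1) m))) = q := by
    intro m
    induction m with
    | zero => simpa using hi
    | succ m ih =>
      have := hcon _ ih
      rw [finRotate_apply, add_assoc] at this
      convert this using 5
      ext
      simp [Fin.val_add]
  refine hk ?_
  -- This is the number of steps along the cycle from `i` to `k`.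
  have := key (σ.symm k - σ.symm i).val
  simpa using this

variable {c₁ c₂ : ℝ} {h : UnitSquare → UnitSquare → ℝ}

theorem IsEdgeWeight.nonneg (hh : IsEdgeWeight c₁ c₂ h) (hc₁ : 0 ≤ c₁) (x y : UnitSquare) :
    0 ≤ h x y := (mul_nonneg hc₁ dist_nonneg).trans (hh.lower x y)

theorem tspWeight_nonneg (hh : IsEdgeWeight c₁ c₂ h) (hc₁ : 0 ≤ c₁) (α : ℝ)
    (x : Fin n → UnitSquare) : 0 ≤ tspWeight h α x :=
  (Finset.le_inf'_iff _ _).2 fun _ _ =>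
    Finset.sum_nonneg fun _ _ => Real.rpow_nonneg (hh.nonneg hc₁ _ _) _

/-- The exit edge of an isolated square ends in a square that is not near it. Having two isolated
squares guarantees a node outside each of them, hence an exit edge. Edges are indexed by their
starting position, which lies in the square, so different squares use different edges. -/
theorem card_isolatedCells_mul_le_tspWeight (hh : IsEdgeWeight c₁ c₂ h) (hc₁ : 0 ≤ c₁) {α : ℝ}
    (hα : 0 ≤ α) {M : ℕ} (hM : 0 < M) (x : Fin n → UnitSquare)
    (hx : 2 ≤ (isolatedCells M x).card) :
    (isolatedCells M x).card * (c₁ * (1 / M)) ^ α ≤ tspWeight h α x := by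
  classical
  refine (Finset.le_inf'_iff _ _).2 fun σ _ => ?_
  have hex : ∀ q : isolatedCells M x, ∃ j, gridCell M (x (σ j)) = q ∧
      gridCell M (x (σ (finRotate n j))) ≠ q := by
    rintro ⟨q, hq⟩
    obtain ⟨q', hq', hne⟩ := Finset.exists_mem_ne (s := isolatedCells M x) (by omega) q
    obtain ⟨i, hi⟩ := ((Finset.mem_filter.1 hq).2).1
    obtain ⟨k, hk⟩ := ((Finset.mem_filter.1 hq').2).1
    exact exists_exit_edge σ hi (by rwa [hk])
  choose J hJ using hex
  have hinj : Function.Injective J := fun p q hpq => by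
    apply Subtype.ext
    rw [← (hJ p).1, ← (hJ q).1, hpq]
  have hnn : ∀ j, 0 ≤ h (x (σ j)) (x (σ (finRotate n j))) ^ α := fun j =>
    Real.rpow_nonneg (hh.nonneg hc₁ _ _) _
  calc (isolatedCells M x).card * (c₁ * (1 / M)) ^ α
      = ∑ _q : isolatedCells M x, (c₁ * (1 / (M : ℝ))) ^ α := by simp
    _ ≤ ∑ q : isolatedCells M x, h (x (σ (J q))) (x (σ (finRotate n (J q)))) ^ α := by
        refine Finset.sum_le_sum fun q _ => ?_
        refine Real.rpow_le_rpow (by positivity) ?_ hα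
        refine le_trans ?_ (hh.lower _ _)
        refine mul_le_mul_of_nonneg_left ?_ hc₁
        refine le_dist_of_not_nearCell hM fun hnear => ?_
        refine (Finset.mem_filter.1 q.2).2.2 _ (hJ q).2 ?_
        rw [(hJ q).1] at hnear
        exact hnear.symm
    _ = ∑ j ∈ Finset.univ.image J, h (x (σ j)) (x (σ (finRotate n j))) ^ α := by
        rw [Finset.sum_image fun _ _ _ _ h => hinj h]
    _ ≤ cycleWeight h α x σ :=
        Finset.sum_le_sum_of_subset_of_nonneg (Finset.subset_univ _) fun j _ _ => hnn j

theorem measurable_gridCell_apply (M : ℕ) (i : Fin n) :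
    Measurable fun x : Fin n → UnitSquare => gridCell M (x i) :=
  (measurable_gridCell M).comp (measurable_pi_apply i)

theorem measurableSet_forall_notMem (M : ℕ) (T : Finset (ℕ × ℕ)) :
    MeasurableSet {x : Fin n → UnitSquare | ∀ i, gridCell M (x i) ∉ T} := by
  have : {x : Fin n → UnitSquare | ∀ i, gridCell M (x i) ∉ T}
      = ⋂ i, (fun x : Fin n → UnitSquare => gridCell M (x i)) ⁻¹' (T : Set (ℕ × ℕ))ᶜ := by
    ext x; simp
  rw [this]
  exact MeasurableSet.iInter fun i =>
    measurable_gridCell_apply M i T.measurableSet.compl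

/-- The squares touching the square `q`. -/
def touchingCells (M : ℕ) (q : ℕ × ℕ) : Finset (ℕ × ℕ) :=
  ((gridCells M).filter fun p => NearCell p q).erase q

theorem card_touchingCells_le {M : ℕ} {q : ℕ × ℕ} (hq : q ∈ gridCells M) :
    (touchingCells M q).card ≤ 8 := by
  have hmem : q ∈ (gridCells M).filter fun p => NearCell p q :=
    Finset.mem_filter.2 ⟨hq, by unfold NearCell; omega⟩
  have := card_filter_nearCell_le M q
  rw [touchingCells, Finset.card_erase_of_mem hmem]
  omega

/-- A difference of two nested avoidance events, whose probabilities under the product measure are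
exact `n`-th powers. -/
theorem setOf_isIsolatedCell {M : ℕ} (hM : 0 < M) (q : ℕ × ℕ) :
    {x : Fin n → UnitSquare | IsIsolatedCell M x q}
      = {x | ∀ i, gridCell M (x i) ∉ touchingCells M q}
        \ {x | ∀ i, gridCell M (x i) ∉ insert q (touchingCells M q)} := by
  ext x
  have hgc : ∀ i, gridCell M (x i) ∈ gridCells M := fun i => gridCell_mem hM _
  simp only [IsIsolatedCell, touchingCells, Set.mem_ofPred_eq, Set.mem_sdiff, Finset.mem_erase,
    Finset.mem_filter, Finset.mem_insert, not_forall, not_not, hgc, true_and, not_and,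
    forall_const]
  constructor
  · rintro ⟨⟨i, hi⟩, h⟩
    exact ⟨h, i, Or.inl hi⟩
  · rintro ⟨h, i, hi | ⟨hi, hi'⟩⟩
    · exact ⟨⟨i, hi⟩, h⟩
    · exact absurd hi' (h i hi)

theorem measurableSet_isIsolatedCell {M : ℕ} (hM : 0 < M) (q : ℕ × ℕ) :
    MeasurableSet {x : Fin n → UnitSquare | IsIsolatedCell M x q} := by
  rw [setOf_isIsolatedCell hM]
  exact (measurableSet_forall_notMem M _).diff (measurableSet_forall_notMem M _)

variable {ε₁ ε₂ : ℝ} {μ : Measure UnitSquare}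

theorem le_pi_real_isIsolatedCell [IsProbabilityMeasure μ] (hμ : IsBoundedLaw ε₁ ε₂ μ)
    (hε₁ : 0 ≤ ε₁) (hε₂ : 0 ≤ ε₂) {M : ℕ} (hM : 0 < M) (hM8 : 8 * ε₂ / (M : ℝ) ^ 2 ≤ 1)
    {q : ℕ × ℕ} (hq : q ∈ gridCells M) :
    (1 - 8 * ε₂ / (M : ℝ) ^ 2) ^ n * (1 - Real.exp (-(ε₁ * (n / (M : ℝ) ^ 2))))
      ≤ (Measure.pi fun _ : Fin n => μ).real {x | IsIsolatedCell M x q} := by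
  have hM' : (0 : ℝ) < M := by exact_mod_cast hM
  have hT : touchingCells M q ⊆ gridCells M :=
    (Finset.erase_subset _ _).trans (Finset.filter_subset _ _)
  have hqT : q ∉ touchingCells M q := Finset.notMem_erase _ _
  set v := μ.real (gridCell M ⁻¹' (touchingCells M q)) with hv
  set w := μ.real (gridCell M ⁻¹' ({q} : Finset (ℕ × ℕ))) with hw
  have hins : μ.real (gridCell M ⁻¹' (insert q (touchingCells M q) : Finset (ℕ × ℕ)))
      = v + w := by
    rw [Finset.coe_insert, Set.insert_eq, Set.preimage_union, add_comm,
      measureReal_union ?_ (measurable_gridCell M (Finset.measurableSet _))]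
    · simp [hw, hv]
    · exact Disjoint.preimage _ (by simpa using hqT)
  have hsum : v + w ≤ 1 := hins ▸ measureReal_le_one
  have hw0 : 0 ≤ w := measureReal_nonneg
  have hv0 : 0 ≤ v := measureReal_nonneg
  have hv8 : v ≤ 8 * ε₂ / (M : ℝ) ^ 2 := by
    refine (hμ.gridCell_le hε₂ hT).trans ?_
    rw [mul_div_assoc', mul_comm 8]
    have : ((touchingCells M q).card : ℝ) ≤ 8 := by exact_mod_cast card_touchingCells_le hq
    gcongr
  have hwl : ε₁ * (1 / (M : ℝ) ^ 2) ≤ w := by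
    have := hμ.le_gridCell hε₁ (T := {q}) (by simpa using hq)
    simpa [hw] using this
  rw [setOf_isIsolatedCell hM, measureReal_sdiff ?_ (measurableSet_forall_notMem M _),
    pi_real_forall_notMem, pi_real_forall_notMem, hins]
  -- Here `v` is the mass of the neighbours and `w` that of the square. The probability is `(1 - v)
  -- ^ n - (1 - v - w) ^ n`; this inequality lets `(1 - v) ^ n` be factored out.
  · have h1 : (1 - (v + w)) ^ n ≤ (1 - v) ^ n * (1 - w) ^ n := by
      rw [← mul_pow]
      refine pow_le_pow_left₀ (by linarith) ?_ n
      nlinarith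
    have h2 : (1 - w) ^ n ≤ Real.exp (-(ε₁ * (n / (M : ℝ) ^ 2))) := by
      calc (1 - w) ^ n ≤ Real.exp (-w) ^ n := by
            refine pow_le_pow_left₀ (by linarith) ?_ n
            linarith [Real.add_one_le_exp (-w)]
        _ = Real.exp (-(n * w)) := by rw [← Real.exp_nat_mul]; ring_nf
        _ ≤ _ := by
            refine Real.exp_le_exp.2 (neg_le_neg ?_)
            calc ε₁ * (n / (M : ℝ) ^ 2) = n * (ε₁ * (1 / (M : ℝ) ^ 2)) := by ring
              _ ≤ n * w := by gcongr
    have h3 : Real.exp (-(ε₁ * (n / (M : ℝ) ^ 2))) ≤ 1 :=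
      Real.exp_le_one_iff.2 (neg_nonpos.2 (by positivity))
    calc (1 - 8 * ε₂ / (M : ℝ) ^ 2) ^ n * (1 - Real.exp (-(ε₁ * (n / (M : ℝ) ^ 2))))
        ≤ (1 - v) ^ n * (1 - Real.exp (-(ε₁ * (n / (M : ℝ) ^ 2)))) := by
          refine mul_le_mul_of_nonneg_right ?_ (by linarith)
          exact pow_le_pow_left₀ (by linarith) (by linarith) n
      _ ≤ (1 - v) ^ n * (1 - (1 - w) ^ n) := by
          refine mul_le_mul_of_nonneg_left (by linarith) (pow_nonneg (by linarith) n)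
      _ ≤ _ := by linarith
  · intro x hx i hi
    exact hx i (Finset.mem_insert_of_mem hi)

theorem card_isolatedCells_eq_sum (M : ℕ) (x : Fin n → UnitSquare) :
    ((isolatedCells M x).card : ℝ)
      = ∑ q ∈ gridCells M, {x | IsIsolatedCell M x q}.indicator (fun _ => (1 : ℝ)) x := by
  classical
  rw [isolatedCells, Finset.card_filter]
  push_cast
  refine Finset.sum_congr rfl fun q _ => ?_
  simp [Set.indicator_apply]

theorem measurable_card_isolatedCells {M : ℕ} (hM : 0 < M) :
    Measurable fun x : Fin n → UnitSquare => ((isolatedCells M x).card : ℝ) := by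
  simp_rw [card_isolatedCells_eq_sum]
  exact Finset.measurable_sum _ fun q _ =>
    measurable_const.indicator (measurableSet_isIsolatedCell hM q)

theorem le_integral_card_isolatedCells [IsProbabilityMeasure μ] (hμ : IsBoundedLaw ε₁ ε₂ μ)
    (hε₁ : 0 ≤ ε₁) (hε₂ : 0 ≤ ε₂) {M : ℕ} (hM : 0 < M) (hM8 : 8 * ε₂ / (M : ℝ) ^ 2 ≤ 1) :
    (M : ℝ) ^ 2 * ((1 - 8 * ε₂ / (M : ℝ) ^ 2) ^ n
        * (1 - Real.exp (-(ε₁ * (n / (M : ℝ) ^ 2)))))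
      ≤ ∫ x, ((isolatedCells M x).card : ℝ) ∂(Measure.pi fun _ : Fin n => μ) := by
  simp_rw [card_isolatedCells_eq_sum]
  rw [integral_finsetSum]
  · simp_rw [integral_indicator_const (1 : ℝ) (measurableSet_isIsolatedCell hM _), smul_eq_mul,
      mul_one]
    calc _ = ∑ _q ∈ gridCells M, ((1 - 8 * ε₂ / (M : ℝ) ^ 2) ^ n
          * (1 - Real.exp (-(ε₁ * (n / (M : ℝ) ^ 2))))) := by
          rw [Finset.sum_const, card_gridCells, nsmul_eq_mul]
          push_cast
          ring
      _ ≤ _ := Finset.sum_le_sum fun q hq => le_pi_real_isIsolatedCell hμ hε₁ hε₂ hM hM8 hq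
  · exact fun q _ => (integrable_const (1 : ℝ)).indicator (measurableSet_isIsolatedCell hM q)

theorem pi_real_card_isolatedCells_le [IsProbabilityMeasure μ] (hμ : IsBoundedLaw ε₁ ε₂ μ)
    (hε₁ : 0 ≤ ε₁) (hε₂ : 0 ≤ ε₂) {M : ℕ} (hM : 0 < M) (hM8 : 8 * ε₂ / (M : ℝ) ^ 2 ≤ 1)
    {t : ℝ} (ht : 0 ≤ t) :
    (Measure.pi fun _ : Fin n => μ).real {x | ((isolatedCells M x).card : ℝ)
        ≤ (M : ℝ) ^ 2 * ((1 - 8 * ε₂ / (M : ℝ) ^ 2) ^ n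
          * (1 - Real.exp (-(ε₁ * (n / (M : ℝ) ^ 2))))) - t}
      ≤ Real.exp (-t ^ 2 / (2 * (n * 18 ^ 2))) := by
  refine le_trans (measureReal_mono ?_) (measure_le_le_of_bounded_differences μ
    (measurable_card_isolatedCells hM) (B := (M : ℝ) ^ 2) (fun x => ?_) (by norm_num : (0 : ℝ) ≤ 18)
    (abs_card_isolatedCells_update_sub_le M) ht)
  · intro x hx
    have := le_integral_card_isolatedCells (n := n) hμ hε₁ hε₂ hM hM8
    simp only [Set.mem_ofPred_eq] at hx ⊢
    linarith
  · rw [abs_of_nonneg (by positivity)]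
    have : (isolatedCells M x).card ≤ (gridCells M).card := by
      classical exact Finset.card_filter_le _ _
    rw [card_gridCells] at this
    exact_mod_cast this

end IsolatedCells

/-! ### A closed walk through all squares by unit steps. -/

section CellTour

/-- A closed walk through the squares of the subdivision that visits each of them once and moves
between squares with a common side. -/
structure CellTour (M : ℕ) where
  /-- The square visited at a given time. -/
  cell : ℕ → ℕ × ℕ
  /-- The time at which a square is visited. -/
  time : ℕ × ℕ → ℕ
  cell_mem : ∀ i, cell i ∈ gridCells M
  cell_mod : ∀ i, cell (i % M ^ 2) = cell i
  time_lt : ∀ q ∈ gridCells M, time q < M ^ 2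
  cell_time : ∀ q ∈ gridCells M, cell (time q) = q
  abs_sub_le : ∀ i j, |((cell i).1 : ℝ) - (cell (i + j)).1|
    + |((cell i).2 : ℝ) - (cell (i + j)).2| ≤ j

/-- A surjection from `M ^ 2` times onto `M ^ 2` squares is injective. -/
theorem CellTour.injOn {M : ℕ} (τ : CellTour M) : Set.InjOn τ.cell (Finset.range (M ^ 2)) := by
  refine Finset.injOn_of_surjOn_of_card_le τ.cell (t := gridCells M)
    (fun i _ => τ.cell_mem i) (fun q hq => ?_) (by rw [Finset.card_range, card_gridCells])
  exact ⟨τ.time q, by simpa using τ.time_lt q hq, τ.cell_time q hq⟩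

/-- The walk which visits the columns `1, …, M - 1` row by row, in alternating directions, and
comes back through the column `0`. -/
def snakePos (M i : ℕ) : ℕ × ℕ :=
  if i < M * (M - 1) then
    (if (i / (M - 1)) % 2 = 0 then 1 + i % (M - 1) else M - 1 - i % (M - 1), i / (M - 1))
  else (0, M - 1 - (i - M * (M - 1)))

theorem snakePos_row {M r t : ℕ} (hr : r < M) (ht : t < M - 1) :
    snakePos M (r * (M - 1) + t) = (if r % 2 = 0 then 1 + t else M - 1 - t, r) := by
  have h1 : (r * (M - 1) + t) / (M - 1) = r := by
    rw [mul_comm, Nat.mul_add_div (by omega), Nat.div_eq_of_lt ht, add_zero]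
  have h2 : (r * (M - 1) + t) % (M - 1) = t := by
    rw [mul_comm, Nat.mul_add_mod, Nat.mod_eq_of_lt ht]
  have h3 : r * (M - 1) + t < M * (M - 1) := by
    have := Nat.mul_le_mul_right (M - 1) (Nat.succ_le_of_lt hr)
    have h4 : r.succ * (M - 1) = r * (M - 1) + (M - 1) := Nat.succ_mul _ _
    omega
  rw [snakePos, if_pos h3, h1, h2]

theorem snakePos_column (M j : ℕ) : snakePos M (M * (M - 1) + j) = (0, M - 1 - j) := by
  rw [snakePos, if_neg (by omega), Nat.add_sub_cancel_left]

/-- Two squares with a common side, or equal. -/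
def CellStep (p q : ℕ × ℕ) : Prop :=
  (p.1 = q.1 ∧ p.2 ≤ q.2 + 1 ∧ q.2 ≤ p.2 + 1) ∨ (p.2 = q.2 ∧ p.1 ≤ q.1 + 1 ∧ q.1 ≤ p.1 + 1)

theorem CellStep.abs_sub_le {p q : ℕ × ℕ} (h : CellStep p q) :
    |(p.1 : ℝ) - q.1| + |(p.2 : ℝ) - q.2| ≤ 1 := by
  obtain ⟨h0, h1, h2⟩ | ⟨h0, h1, h2⟩ := h
  · have h1' : (p.2 : ℝ) ≤ q.2 + 1 := by exact_mod_cast h1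
    have h2' : (q.2 : ℝ) ≤ p.2 + 1 := by exact_mod_cast h2
    rw [h0, sub_self, abs_zero, zero_add, abs_le]
    constructor <;> linarith
  · have h1' : (p.1 : ℝ) ≤ q.1 + 1 := by exact_mod_cast h1
    have h2' : (q.1 : ℝ) ≤ p.1 + 1 := by exact_mod_cast h2
    rw [h0, sub_self, abs_zero, add_zero, abs_le]
    constructor <;> linarith

theorem sq_eq_mul_pred_add {M : ℕ} (hM : 0 < M) : M ^ 2 = M * (M - 1) + M := by
  obtain ⟨m, rfl⟩ : ∃ m, M = m + 1 := ⟨M - 1, by omega⟩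
  simp only [Nat.add_sub_cancel]
  ring

theorem exists_row_or_column {M i : ℕ} (hM : 2 ≤ M) (hi : i < M ^ 2) :
    (∃ r t, r < M ∧ t < M - 1 ∧ i = r * (M - 1) + t) ∨ ∃ j < M, i = M * (M - 1) + j := by
  rw [sq_eq_mul_pred_add (by omega)] at hi
  by_cases h : i < M * (M - 1)
  · refine Or.inl ⟨i / (M - 1), i % (M - 1), ?_, Nat.mod_lt _ (by omega), ?_⟩
    · rwa [Nat.div_lt_iff_lt_mul (by omega)]
    · rw [mul_comm, Nat.div_add_mod]
  · exact Or.inr ⟨i - M * (M - 1), by omega, by omega⟩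

/-- Evenness of `M` closes the walk: the last row `M - 1` is odd, so it is run backwards and ends in
column `1`, next to the entrance of the return column `0`. -/
theorem cellStep_snakePos {M : ℕ} (hM : 2 ≤ M) (hM2 : M % 2 = 0) {i : ℕ} (hi : i < M ^ 2) :
    CellStep (snakePos M i) (snakePos M ((i + 1) % M ^ 2)) := by
  have hsq := sq_eq_mul_pred_add (M := M) (by omega)
  obtain ⟨r, t, hr, ht, rfl⟩ | ⟨j, hj, rfl⟩ := exists_row_or_column hM hi
  · have hsucc : (r + 1) * (M - 1) = r * (M - 1) + (M - 1) := Nat.succ_mul _ _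
    have hle := Nat.mul_le_mul_right (M - 1) (Nat.succ_le_of_lt hr)
    rw [Nat.succ_eq_add_one] at hle
    rw [Nat.mod_eq_of_lt (by omega), snakePos_row hr ht]
    by_cases ht' : t + 1 < M - 1
    · rw [add_assoc, snakePos_row hr ht']
      refine Or.inr ⟨rfl, ?_⟩
      dsimp only
      split_ifs <;> omega
    · have he : r * (M - 1) + t + 1 = (r + 1) * (M - 1) + 0 := by omega
      rw [he]
      by_cases hr' : r + 1 < M
      · rw [snakePos_row hr' (by omega)]
        refine Or.inl ⟨?_, ?_⟩
        · dsimp only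
          split_ifs <;> omega
        · dsimp only
          omega
      · have hrM : r + 1 = M := by omega
        rw [hrM, snakePos_column]
        refine Or.inr ⟨?_, ?_⟩
        · dsimp only
          omega
        · dsimp only
          rw [if_neg (by omega)]
          omega
  · rw [snakePos_column]
    by_cases hj' : j + 1 < M
    · rw [Nat.mod_eq_of_lt (by omega), add_assoc, snakePos_column]
      refine Or.inl ⟨rfl, ?_⟩
      dsimp only
      omega
    · have he : M * (M - 1) + j + 1 = M ^ 2 := by omega
      have h0 := snakePos_row (M := M) (r := 0) (t := 0) (by omega) (by omega)
      rw [zero_mul, zero_add] at h0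
      rw [he, Nat.mod_self, h0]
      refine Or.inr ⟨?_, ?_⟩
      · dsimp only
        omega
      · simp

theorem exists_snakePos_eq {M : ℕ} (hM : 2 ≤ M) {q : ℕ × ℕ} (hq : q ∈ gridCells M) :
    ∃ i < M ^ 2, snakePos M i = q := by
  obtain ⟨c, r⟩ := q
  obtain ⟨hc, hr⟩ : c < M ∧ r < M := by simpa [gridCells] using hq
  have hsq := sq_eq_mul_pred_add (M := M) (by omega)
  have hsucc : (r + 1) * (M - 1) = r * (M - 1) + (M - 1) := Nat.succ_mul _ _
  have hle := Nat.mul_le_mul_right (M - 1) (Nat.succ_le_of_lt hr)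
  rw [Nat.succ_eq_add_one] at hle
  rcases Nat.eq_zero_or_pos c with rfl | hc0
  · refine ⟨M * (M - 1) + (M - 1 - r), by omega, ?_⟩
    rw [snakePos_column]
    congr 1
    omega
  · by_cases h2 : r % 2 = 0
    · refine ⟨r * (M - 1) + (c - 1), by omega, ?_⟩
      rw [snakePos_row hr (by omega), if_pos h2]
      congr 1
      omega
    · refine ⟨r * (M - 1) + (M - 1 - c), by omega, ?_⟩
      rw [snakePos_row hr (by omega), if_neg h2]
      congr 1
      omega

theorem snakePos_mem {M : ℕ} (hM : 2 ≤ M) {i : ℕ} (hi : i < M ^ 2) :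
    snakePos M i ∈ gridCells M := by
  obtain ⟨r, t, hr, ht, rfl⟩ | ⟨j, hj, rfl⟩ := exists_row_or_column hM hi
  · rw [snakePos_row hr ht]
    simp only [gridCells, Finset.mem_product, Finset.mem_range]
    split_ifs <;> omega
  · rw [snakePos_column]
    simp only [gridCells, Finset.mem_product, Finset.mem_range]
    omega

/-- The snake is extended periodically in time; the bound on displacements follows from unit steps
by the triangle inequality. -/
theorem nonempty_cellTour {M : ℕ} (hM : 2 ≤ M) (hM2 : M % 2 = 0) : Nonempty (CellTour M) := by
  have hex : ∀ q, ∃ i, q ∈ gridCells M → i < M ^ 2 ∧ snakePos M i = q := fun q => by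
    by_cases hq : q ∈ gridCells M
    · obtain ⟨i, hi⟩ := exists_snakePos_eq hM hq
      exact ⟨i, fun _ => hi⟩
    · exact ⟨0, fun h => absurd h hq⟩
  choose κ hκ using hex
  have hpos : 0 < M ^ 2 := by positivity
  refine ⟨⟨fun i => snakePos M (i % M ^ 2), κ, fun i => snakePos_mem hM (Nat.mod_lt _ hpos),
    fun i => by rw [Nat.mod_mod], fun q hq => (hκ q hq).1, fun q hq => ?_, fun i j => ?_⟩⟩
  · rw [Nat.mod_eq_of_lt (hκ q hq).1, (hκ q hq).2]
  · induction j with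
    | zero => simp
    | succ j ih =>
      have hstep := (cellStep_snakePos hM hM2 (Nat.mod_lt (i + j) hpos)).abs_sub_le
      rw [Nat.mod_add_mod] at hstep
      rw [← add_assoc]
      push_cast
      have h1 := abs_sub_le ((snakePos M (i % M ^ 2)).1 : ℝ) (snakePos M ((i + j) % M ^ 2)).1
        (snakePos M ((i + j + 1) % M ^ 2)).1
      have h2 := abs_sub_le ((snakePos M (i % M ^ 2)).2 : ℝ) (snakePos M ((i + j) % M ^ 2)).2
        (snakePos M ((i + j + 1) % M ^ 2)).2
      linarith

end CellTour

/-! ### The tour in the order of the squares, and its weight in terms of gaps. -/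

section TourAlongCells

variable {n M : ℕ}

theorem CellTour.mod_eq_of_cell_eq (τ : CellTour M) (hM : 0 < M) {i j : ℕ}
    (h : τ.cell i = τ.cell j) : i % M ^ 2 = j % M ^ 2 := by
  have hpos : 0 < M ^ 2 := by positivity
  refine τ.injOn ?_ ?_ (by rw [τ.cell_mod, τ.cell_mod, h])
  · simpa using Nat.mod_lt _ hpos
  · simpa using Nat.mod_lt _ hpos

/-- Visiting the nodes in the order of their squares: `k j` is the time of the square of the
`j`-th node, with `k (n + 1)` one full turn after `k 0`. -/
theorem exists_perm_gaps (τ : CellTour M) (hM : 0 < M) (x : Fin (n + 1) → UnitSquare) :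
    ∃ (σ : Equiv.Perm (Fin (n + 1))) (k : ℕ → ℕ),
      (∀ j < n + 1, k j ≤ k (j + 1)) ∧ k (n + 1) = k 0 + M ^ 2 ∧
      (∀ j : Fin (n + 1), dist (x (σ j)) (x (σ (finRotate (n + 1) j)))
        ≤ (((k (j + 1) : ℝ) - k j) + 2) / M) ∧
      ∀ j < n + 1, ∀ c, k j < c → c < k (j + 1) → ∀ i, gridCell M (x i) ≠ τ.cell c := by
  set K : Fin (n + 1) → ℕ := fun i => τ.time (gridCell M (x i)) with hK
  set σ := Tuple.sort K with hσ
  have hmono : Monotone (K ∘ σ) := Tuple.monotone_sort K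
  -- The value past the end is the first time plus one period, so that the closing edge is a gap
  -- like the others.
  set k : ℕ → ℕ := fun j => if h : j < n + 1 then K (σ ⟨j, h⟩) else K (σ 0) + M ^ 2 with hk
  have hKlt : ∀ i, K i < M ^ 2 := fun i => τ.time_lt _ (gridCell_mem hM _)
  have hKcell : ∀ i, τ.cell (K i) = gridCell M (x i) := fun i =>
    τ.cell_time _ (gridCell_mem hM _)
  have hk_lt : ∀ j (h : j < n + 1), k j = K (σ ⟨j, h⟩) := fun j h => dif_pos h
  have hk_last : k (n + 1) = K (σ 0) + M ^ 2 := dif_neg (lt_irrefl _)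
  have hk0 : k 0 = K (σ 0) := hk_lt 0 (Nat.succ_pos n)
  have hkle : ∀ i j, i ≤ j → j < n + 1 → k i ≤ k j := fun i j hij hj => by
    rw [hk_lt i (by omega), hk_lt j hj]
    exact hmono (show (⟨i, by omega⟩ : Fin (n + 1)) ≤ ⟨j, hj⟩ from hij)
  have hstep : ∀ j < n + 1, k j ≤ k (j + 1) := fun j hj => by
    by_cases hj' : j + 1 < n + 1
    · exact hkle _ _ (Nat.le_succ j) hj'
    · obtain rfl : j = n := by omega
      rw [hk_last, hk_lt j hj]
      exact (hKlt _).le.trans (Nat.le_add_left _ _)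
  have hcell : ∀ j : Fin (n + 1), τ.cell (k j) = gridCell M (x (σ j)) := fun j => by
    rw [hk_lt j j.2]
    exact hKcell _
  have hcell' : ∀ j : Fin (n + 1),
      τ.cell (k (j + 1)) = gridCell M (x (σ (finRotate (n + 1) j))) := fun j => by
    by_cases hj : (j : ℕ) < n
    · have : finRotate (n + 1) j = ⟨j + 1, by omega⟩ := finRotate_of_lt hj
      rw [this, hk_lt (j + 1) (by omega)]
      exact hKcell _
    · have hjn : j = Fin.last n := Fin.ext (by simp; omega)
      rw [hjn, finRotate_last, Fin.val_last, hk_last, ← τ.cell_mod, Nat.add_mod_right,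
        τ.cell_mod]
      exact hKcell _
  refine ⟨σ, k, hstep, by rw [hk_last, hk0], fun j => ?_, fun j hj c hc1 hc2 i hi => ?_⟩
  · refine (dist_le_of_gridCell hM _ _).trans ?_
    have h1 := τ.abs_sub_le (k j) (k (j + 1) - k j)
    rw [Nat.add_sub_of_le (hstep j j.2), Nat.cast_sub (hstep j j.2), hcell, hcell'] at h1
    gcongr
  -- A node in the square visited at time `c` has time `c` modulo `M ^ 2`. If `c < M ^ 2`, this time
  -- would lie strictly between consecutive sorted times. If `c ≥ M ^ 2`, the gap is the closing one
  -- and the time `c - M ^ 2` would precede the smallest time `k 0`.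
  · have hmod : K i % M ^ 2 = c % M ^ 2 :=
      τ.mod_eq_of_cell_eq hM (by rw [hKcell, hi])
    rw [Nat.mod_eq_of_lt (hKlt i)] at hmod
    obtain ⟨l, rfl⟩ := σ.surjective i
    have hKl : K (σ l) = k l := (hk_lt l l.2).symm
    have hl0 : k 0 ≤ k l := hkle 0 l (Nat.zero_le _) l.2
    by_cases hcN : c < M ^ 2
    · rw [Nat.mod_eq_of_lt hcN, hKl] at hmod
      rcases Nat.lt_or_ge j l with hjl | hjl
      · have := hkle (j + 1) l hjl l.2
        omega
      · have := hkle l j hjl hj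
        omega
    · have hjn : ¬ j + 1 < n + 1 := fun hj' => by
        have := hKlt (σ ⟨j + 1, hj'⟩)
        rw [← hk_lt] at this
        omega
      obtain rfl : j = n := by omega
      rw [hk_last, ← hk0] at hc2
      have h3 : c % M ^ 2 = c - M ^ 2 := by
        have := hKlt (σ 0)
        rw [← hk0] at this
        rw [Nat.mod_eq_sub_mod (by omega), Nat.mod_eq_of_lt (by omega)]
      omega

theorem sum_gaps {k : ℕ → ℕ} (hk : k (n + 1) = k 0 + M ^ 2) :
    ∑ j : Fin (n + 1), ((k (j + 1) : ℝ) - k j) = (M : ℝ) ^ 2 := by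
  rw [Fin.sum_univ_eq_sum_range (fun j => (k (j + 1) : ℝ) - k j) (n + 1),
    Finset.sum_range_sub (fun j => (k j : ℝ)), hk]
  push_cast
  ring

/-- The sequence of differences `b 0, b 1 - b 0, b 2 - b 1, …`. -/
def diffSeq (b : ℕ → ℝ) : ℕ → ℝ
  | 0 => b 0
  | j + 1 => b (j + 1) - b j

theorem sum_range_succ_diffSeq (b : ℕ → ℝ) (m : ℕ) :
    ∑ l ∈ Finset.range (m + 1), diffSeq b l = b m := by
  induction m with
  | zero => simp [diffSeq]
  | succ m ih => rw [Finset.sum_range_succ, ih, diffSeq]; ring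

/-- The second differences of the sequence `1 ^ α, 2 ^ α, …`. -/
noncomputable def gapCoeff (α : ℝ) : ℕ → ℝ := diffSeq (diffSeq fun j => ((j : ℝ) + 1) ^ α)

/-- Convexity of `t ^ α`. The first two coefficients, `1` and `2 ^ α - 2`, are treated apart because
`diffSeq` starts as if preceded by zero. -/
theorem gapCoeff_nonneg {α : ℝ} (hα : 1 ≤ α) (l : ℕ) : 0 ≤ gapCoeff α l := by
  rcases l with _ | _ | l
  · simp [gapCoeff, diffSeq]
  · have h : (2 : ℝ) ^ (1 : ℝ) ≤ 2 ^ α := Real.rpow_le_rpow_of_exponent_le (by norm_num) hα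
    rw [Real.rpow_one] at h
    have h1 : (1 : ℝ) + 1 = 2 := by norm_num
    simp only [gapCoeff, diffSeq, Nat.cast_zero, zero_add, Real.one_rpow, Nat.cast_one, h1]
    linarith
  · have hc := (convexOn_rpow hα).2 (Set.mem_Ici.2 (by positivity : (0 : ℝ) ≤ (l : ℝ) + 1))
      (Set.mem_Ici.2 (by positivity : (0 : ℝ) ≤ (l : ℝ) + 3))
      (by norm_num : (0 : ℝ) ≤ 1 / 2) (by norm_num : (0 : ℝ) ≤ 1 / 2) (by norm_num)
    simp only [smul_eq_mul] at hc
    have h2 : (1 : ℝ) / 2 * (l + 1) + 1 / 2 * (l + 3) = l + 2 := by ring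
    rw [h2] at hc
    simp only [gapCoeff, diffSeq]
    push_cast
    have h3 : (l : ℝ) + 1 + 1 + 1 = l + 3 := by ring
    have h4 : (l : ℝ) + 1 + 1 = l + 2 := by ring
    rw [h3, h4]
    linarith

/-- The sum telescopes to the single difference `L ^ α - (L - 1) ^ α` when `L ≥ 1`. -/
theorem sum_range_gapCoeff_le {α : ℝ} (hα : 0 < α) (L : ℕ) :
    ∑ l ∈ Finset.range L, gapCoeff α l ≤ (L : ℝ) ^ α := by
  rcases L with _ | _ | L
  · simp [hα.ne']
  · simp [gapCoeff, diffSeq]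
  · rw [gapCoeff, sum_range_succ_diffSeq, diffSeq]
    push_cast
    have : 0 ≤ ((L : ℝ) + 1) ^ α := by positivity
    linarith

/-- The `l` squares visited after time `c`. -/
def CellTour.run (τ : CellTour M) (c l : ℕ) : Finset (ℕ × ℕ) := (Finset.Ioc c (c + l)).image τ.cell

theorem CellTour.run_subset (τ : CellTour M) (c l : ℕ) : τ.run c l ⊆ gridCells M := by
  intro q hq
  obtain ⟨i, _, rfl⟩ := Finset.mem_image.1 hq
  exact τ.cell_mem i

theorem CellTour.mem_run {τ : CellTour M} {c l : ℕ} {q : ℕ × ℕ} :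
    q ∈ τ.run c l ↔ ∃ s ∈ Finset.Icc 1 l, τ.cell (c + s) = q := by
  simp only [CellTour.run, Finset.mem_image, Finset.mem_Ioc, Finset.mem_Icc]
  constructor
  · rintro ⟨i, hi, rfl⟩
    exact ⟨i - c, by omega, by rw [Nat.add_sub_of_le (by omega)]⟩
  · rintro ⟨s, hs, rfl⟩
    exact ⟨c + s, by omega, rfl⟩

theorem CellTour.run_mono (τ : CellTour M) (c : ℕ) {l m : ℕ} (h : l ≤ m) :
    τ.run c l ⊆ τ.run c m :=
  Finset.image_subset_image (Finset.Ioc_subset_Ioc_right (by omega))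

theorem CellTour.run_mod (τ : CellTour M) (c l : ℕ) : τ.run (c % M ^ 2) l = τ.run c l := by
  ext q
  simp only [CellTour.mem_run]
  have : ∀ s, τ.cell (c % M ^ 2 + s) = τ.cell (c + s) := fun s => by
    rw [← τ.cell_mod, Nat.mod_add_mod, τ.cell_mod]
  simp_rw [this]

/-- A stretch of at most one period repeats no square. -/
theorem CellTour.card_run (τ : CellTour M) (hM : 0 < M) (c : ℕ) {l : ℕ} (hl : l ≤ M ^ 2) :
    (τ.run c l).card = l := by
  rw [CellTour.run, Finset.card_image_of_injOn]
  · simp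
  · intro i hi j hj hij
    simp only [Finset.coe_Ioc, Set.mem_Ioc] at hi hj
    have h : i ≡ j [MOD M ^ 2] := τ.mod_eq_of_cell_eq hM hij
    rcases le_total i j with h' | h'
    · have := (Nat.modEq_iff_dvd' h').1 h
      have := Nat.eq_zero_of_dvd_of_lt this (by omega)
      omega
    · have := (Nat.modEq_iff_dvd' h').1 h.symm
      have := Nat.eq_zero_of_dvd_of_lt this (by omega)
      omega

open Classical in
/-- The total weight of the runs of at most `L` empty squares that start after time `c`. -/
noncomputable def CellTour.emptyRunSum (τ : CellTour M) (α : ℝ) (L : ℕ) (x : Fin n → UnitSquare)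
    (c : ℕ) : ℝ :=
  ∑ l ∈ Finset.range L, if ∀ i, gridCell M (x i) ∉ τ.run c l then gapCoeff α l else 0

/-- An upper bound for the sum of the `α`-th powers of the gaps between occupied squares. -/
noncomputable def CellTour.gapSum (τ : CellTour M) (α : ℝ) (L : ℕ) (x : Fin n → UnitSquare) : ℝ :=
  ∑ c ∈ Finset.range (M ^ 2), τ.emptyRunSum α L x c

theorem sum_Ico_of_mod_eq {N : ℕ} {φ : ℕ → ℝ} (hφ : ∀ c, φ (c % N) = φ c) (a : ℕ) :
    ∑ c ∈ Finset.Ico a (a + N), φ c = ∑ c ∈ Finset.range N, φ c := by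
  induction a with
  | zero => rw [zero_add, ← Finset.range_eq_Ico]
  | succ a ih =>
    rcases Nat.eq_zero_or_pos N with rfl | hN
    · simp
    rw [← ih, Finset.sum_eq_sum_Ico_succ_bot (by omega : a < a + N),
      show a + 1 + N = a + N + 1 by ring, Finset.sum_Ico_succ_top (by omega), add_comm]
    congr 1
    rw [← hφ (a + N), Nat.add_mod_right, hφ]

theorem sum_Ico_consecutive_of_le {φ : ℕ → ℝ} {k : ℕ → ℕ} (n : ℕ)
    (hk : ∀ j < n, k j ≤ k (j + 1)) :
    ∑ j ∈ Finset.range n, ∑ c ∈ Finset.Ico (k j) (k (j + 1)), φ c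
      = ∑ c ∈ Finset.Ico (k 0) (k n), φ c := by
  have key : k 0 ≤ k n ∧ ∑ j ∈ Finset.range n, ∑ c ∈ Finset.Ico (k j) (k (j + 1)), φ c
      = ∑ c ∈ Finset.Ico (k 0) (k n), φ c := by
    induction n with
    | zero => simp
    | succ n ih =>
      obtain ⟨h1, h2⟩ := ih fun j hj => hk j (by omega)
      have h3 := hk n (by omega)
      refine ⟨h1.trans h3, ?_⟩
      rw [Finset.sum_range_succ, h2, Finset.sum_Ico_consecutive _ h1 h3]
  exact key.2

/-- The power of the gap is the sum of the first differences of `j ^ α`, and the `i`-th of these is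
the sum of `gapCoeff α l` over `l ≤ i`. The `i`-th is charged to the time `c = b - 1 - i`: the
squares visited after `c` and before `b` are empty, so all runs of length `l ≤ i` starting there
count. This is why the sum over `c` is reflected. -/
theorem rpow_le_sum_emptyRunSum (τ : CellTour M) {α : ℝ} (hα : 1 ≤ α) {L a b : ℕ}
    (hab : a ≤ b) (hL : b - a ≤ L) {x : Fin n → UnitSquare}
    (hx : ∀ c, a < c → c < b → ∀ i, gridCell M (x i) ≠ τ.cell c) :
    ((b : ℝ) - a) ^ α ≤ ∑ c ∈ Finset.Ico a b, τ.emptyRunSum α L x c := by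
  obtain ⟨g, rfl⟩ := Nat.exists_eq_add_of_le hab
  rw [Finset.sum_Ico_eq_sum_range, Nat.add_sub_cancel_left,
    ← Finset.sum_range_reflect (fun i => τ.emptyRunSum α L x (a + i))]
  rcases g with _ | g
  · simp [(by linarith : α ≠ 0)]
  have h1 : (((a + (g + 1) : ℕ) : ℝ) - a) ^ α
      = ∑ i ∈ Finset.range (g + 1), diffSeq (fun j => ((j : ℝ) + 1) ^ α) i := by
    rw [sum_range_succ_diffSeq]
    push_cast
    ring_nf
  rw [h1]
  refine Finset.sum_le_sum fun i hi => ?_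
  have hi' := Finset.mem_range.1 hi
  rw [← sum_range_succ_diffSeq (diffSeq fun j => ((j : ℝ) + 1) ^ α)]
  change ∑ l ∈ Finset.range (i + 1), gapCoeff α l ≤ _
  rw [CellTour.emptyRunSum]
  refine le_trans (le_of_eq (Finset.sum_congr rfl fun l hl => ?_))
    (Finset.sum_le_sum_of_subset_of_nonneg (Finset.range_mono (by omega : i + 1 ≤ L))
      fun l _ _ => ?_)
  · rw [if_pos]
    intro j hj
    obtain ⟨s, hs, he⟩ := CellTour.mem_run.1 hj
    have hl' := Finset.mem_range.1 hl
    have hs' := Finset.mem_Icc.1 hs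
    exact hx _ (by omega) (by omega) j he.symm
  · split_ifs
    exacts [gapCoeff_nonneg hα l, le_rfl]

/-- A gap longer than `L` would contain an empty run of `L` squares, against `hL`. The gaps tile one
full period, and `emptyRunSum` is periodic in its starting time. -/
theorem sum_rpow_gaps_le (τ : CellTour M) {α : ℝ} (hα : 1 ≤ α) {L : ℕ}
    {x : Fin n → UnitSquare} {k : ℕ → ℕ} (hM : 0 < M) (hk : ∀ j < n, k j ≤ k (j + 1))
    (hkn : k n = k 0 + M ^ 2)
    (hx : ∀ j < n, ∀ c, k j < c → c < k (j + 1) → ∀ i, gridCell M (x i) ≠ τ.cell c)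
    (hL : ∀ c < M ^ 2, ∃ i, gridCell M (x i) ∈ τ.run c L) :
    ∑ j : Fin n, ((k (j + 1) : ℝ) - k j) ^ α ≤ τ.gapSum α L x := by
  have hgap : ∀ j < n, k (j + 1) - k j ≤ L := by
    intro j hj
    by_contra! hcon
    obtain ⟨i, hi⟩ := hL (k j % M ^ 2) (Nat.mod_lt _ (by positivity))
    rw [τ.run_mod] at hi
    obtain ⟨s, hs, he⟩ := CellTour.mem_run.1 hi
    have hs' := Finset.mem_Icc.1 hs
    exact hx j hj (k j + s) (by omega) (by omega) i he.symm
  rw [Fin.sum_univ_eq_sum_range (fun j => ((k (j + 1) : ℝ) - k j) ^ α) n, CellTour.gapSum,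
    ← sum_Ico_of_mod_eq (φ := τ.emptyRunSum α L x)
      (fun c => by simp only [CellTour.emptyRunSum, τ.run_mod]) (k 0), ← hkn,
    ← sum_Ico_consecutive_of_le n hk]
  refine Finset.sum_le_sum fun j hj => ?_
  have hj' := Finset.mem_range.1 hj
  exact rpow_le_sum_emptyRunSum τ hα (hk j hj') (hgap j hj') (hx j hj')

variable {c₁ c₂ : ℝ} {h : UnitSquare → UnitSquare → ℝ}

/-- The weight of an edge, in terms of the gap of the squares of its end points. -/
theorem rpow_nat_add_two_le {α : ℝ} (hα : 0 < α) (g : ℕ) :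
    ((g : ℝ) + 2) ^ α ≤ 2 ^ α * (1 + (3 / 2) ^ α * g + (g : ℝ) ^ α) := by
  -- The constant term covers `g = 0`; the coefficient `(3 / 2) ^ α` makes `g = 1` work, as `2 ^ α *
  -- (3 / 2) ^ α = 3 ^ α`; for `g ≥ 2` one has `g + 2 ≤ 2 * g`.
  rcases g with _ | _ | g
  · simp [hα.ne']
  · have h1 : (2 : ℝ) ^ α * (3 / 2) ^ α = 3 ^ α := by
      rw [← Real.mul_rpow (by norm_num) (by norm_num)]
      norm_num
    have h2 : (0 : ℝ) ≤ 2 ^ α := by positivity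
    have h3 : (((0 + 1 : ℕ) : ℝ) + 2) = 3 := by norm_num
    rw [h3]
    simp only [zero_add, Nat.cast_one, mul_one, Real.one_rpow]
    nlinarith
  · have h1 : ((g + 1 + 1 : ℕ) : ℝ) + 2 ≤ 2 * (g + 1 + 1 : ℕ) := by
      push_cast
      linarith [g.cast_nonneg (α := ℝ)]
    refine (Real.rpow_le_rpow (by positivity) h1 hα.le).trans ?_
    rw [Real.mul_rpow (by norm_num) (by positivity)]
    refine mul_le_mul_of_nonneg_left ?_ (by positivity)
    have : (0 : ℝ) ≤ (3 / 2 : ℝ) ^ α * (g + 1 + 1 : ℕ) := by positivity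
    linarith

/-- Summing the edge bound over the tour, the constants give `n`, the linear terms give the total
gap `M ^ 2`, and the powers are bounded by `gapSum`. -/
theorem tspWeight_le_of_run (hh : IsEdgeWeight c₁ c₂ h) (hc₁ : 0 ≤ c₁) (hc₂ : 0 ≤ c₂) {α : ℝ}
    (hα : 1 ≤ α) (hM : 0 < M) (τ : CellTour M) {L : ℕ} (hn : 0 < n) {x : Fin n → UnitSquare}
    (hL : ∀ c < M ^ 2, ∃ i, gridCell M (x i) ∈ τ.run c L) :
    tspWeight h α x ≤ (2 * c₂ / M) ^ α * (n + (3 / 2) ^ α * (M : ℝ) ^ 2 + τ.gapSum α L x) := by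
  obtain ⟨n, rfl⟩ : ∃ m, n = m + 1 := ⟨n - 1, by omega⟩
  obtain ⟨σ, k, hk, hkn, hd, hx⟩ := exists_perm_gaps τ hM x
  refine (Finset.inf'_le _ (Finset.mem_univ σ)).trans ?_
  have hterm : ∀ j : Fin (n + 1), h (x (σ j)) (x (σ (finRotate (n + 1) j))) ^ α
      ≤ (2 * c₂ / M) ^ α * (1 + (3 / 2) ^ α * ((k (j + 1) : ℝ) - k j)
        + ((k (j + 1) : ℝ) - k j) ^ α) := by
    intro j
    obtain ⟨g, hg⟩ := Nat.exists_eq_add_of_le (hk j j.2)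
    have hg' : (k (j + 1) : ℝ) - k j = g := by rw [hg]; push_cast; ring
    have hdj := hd j
    rw [hg'] at hdj ⊢
    have h1 : h (x (σ j)) (x (σ (finRotate (n + 1) j))) ≤ c₂ / M * (g + 2) := by
      refine (hh.upper _ _).trans ((mul_le_mul_of_nonneg_left hdj hc₂).trans (le_of_eq ?_))
      ring
    refine (Real.rpow_le_rpow (hh.nonneg hc₁ _ _) h1 (by linarith)).trans ?_
    rw [Real.mul_rpow (by positivity) (by positivity)]
    refine (mul_le_mul_of_nonneg_left (rpow_nat_add_two_le (by linarith) g)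
      (by positivity)).trans (le_of_eq ?_)
    rw [mul_div_assoc, Real.mul_rpow (by norm_num) (by positivity)]
    ring
  refine (Finset.sum_le_sum fun j _ => hterm j).trans ?_
  rw [← Finset.mul_sum, Finset.sum_add_distrib, Finset.sum_add_distrib, ← Finset.mul_sum,
    sum_gaps hkn]
  refine mul_le_mul_of_nonneg_left ?_ (by positivity)
  have := sum_rpow_gaps_le τ hα hM hk hkn hx hL
  simp only [Finset.sum_const, Finset.card_univ, Fintype.card_fin, nsmul_eq_mul, mul_one]
  linarith

/-- A deterministic bound for exponents at most one. -/
theorem tspWeight_le_of_le_one (hh : IsEdgeWeight c₁ c₂ h) (hc₁ : 0 ≤ c₁) (hc₂ : 0 ≤ c₂) {α : ℝ}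
    (hα : 0 < α) (hα1 : α ≤ 1) (hM : 0 < M) (τ : CellTour M) (hn : 0 < n)
    (x : Fin n → UnitSquare) :
    tspWeight h α x ≤ n * (c₂ * ((2 * n + (M : ℝ) ^ 2) / M) / n) ^ α := by
  obtain ⟨n, rfl⟩ : ∃ m, n = m + 1 := ⟨n - 1, by omega⟩
  obtain ⟨σ, k, hk, hkn, hd, hx⟩ := exists_perm_gaps τ hM x
  refine (Finset.inf'_le _ (Finset.mem_univ σ)).trans ?_
  have hn' : (0 : ℝ) < (n + 1 : ℕ) := by positivity
  have hsum : ∑ j, h (x (σ j)) (x (σ (finRotate (n + 1) j)))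
      ≤ c₂ * ((2 * (n + 1 : ℕ) + (M : ℝ) ^ 2) / M) := by
    calc _ ≤ ∑ j : Fin (n + 1), c₂ * ((((k (j + 1) : ℝ) - k j) + 2) / M) :=
          Finset.sum_le_sum fun j _ =>
            (hh.upper _ _).trans (mul_le_mul_of_nonneg_left (hd j) hc₂)
      _ = _ := by
          rw [← Finset.mul_sum, ← Finset.sum_div, Finset.sum_add_distrib, sum_gaps hkn]
          simp only [Finset.sum_const, Finset.card_univ, Fintype.card_fin, nsmul_eq_mul]
          ring
  -- Jensen's inequality with uniform weights reduces the sum of the powers to the total length.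
  have hcon := (Real.concaveOn_rpow hα.le hα1).le_map_sum (t := Finset.univ)
    (w := fun _ : Fin (n + 1) => 1 / ((n + 1 : ℕ) : ℝ))
    (p := fun j => h (x (σ j)) (x (σ (finRotate (n + 1) j))))
    (fun _ _ => by positivity) (by simp; field_simp)
    (fun j _ => hh.nonneg hc₁ _ _)
  simp only [smul_eq_mul, ← Finset.mul_sum] at hcon
  rw [div_mul_eq_mul_div, one_mul, div_mul_eq_mul_div, one_mul, div_le_iff₀ hn', mul_comm] at hcon
  refine hcon.trans (mul_le_mul_of_nonneg_left ?_ hn'.le)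
  refine Real.rpow_le_rpow (div_nonneg (Finset.sum_nonneg fun j _ => hh.nonneg hc₁ _ _) hn'.le)
    ?_ hα.le
  gcongr

/-- A crude bound for the minimum weight of a cycle. -/
theorem tspWeight_le_mul (hh : IsEdgeWeight c₁ c₂ h) (hc₁ : 0 ≤ c₁) (hc₂ : 0 ≤ c₂) {α : ℝ}
    (hα : 0 ≤ α) (x : Fin n → UnitSquare) : tspWeight h α x ≤ n * (2 * c₂) ^ α := by
  refine (Finset.inf'_le _ (Finset.mem_univ (Equiv.refl _))).trans ?_
  calc cycleWeight h α x (Equiv.refl _) ≤ ∑ _j : Fin n, (2 * c₂) ^ α := by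
        refine Finset.sum_le_sum fun j _ => Real.rpow_le_rpow (hh.nonneg hc₁ _ _) ?_ hα
        refine (hh.upper _ _).trans ?_
        rw [mul_comm 2]
        exact mul_le_mul_of_nonneg_left (dist_unitSquare_le_two _ _) hc₂
    _ = _ := by simp

end TourAlongCells

/-! ### Mean and concentration of the gap sum. -/

section GapSum

variable {n M : ℕ}

/-- For each offset `s ≤ L` only one starting time puts `q` at that offset. -/
theorem CellTour.card_filter_mem_run_le (τ : CellTour M) (hM : 0 < M) (L : ℕ) (q : ℕ × ℕ) :
    ((Finset.range (M ^ 2)).filter fun c => q ∈ τ.run c L).card ≤ L := by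
  have hsub : ((Finset.range (M ^ 2)).filter fun c => q ∈ τ.run c L)
      ⊆ (Finset.Icc 1 L).biUnion fun s =>
        (Finset.range (M ^ 2)).filter fun c => τ.cell (c + s) = q := by
    intro c hc
    obtain ⟨hc1, hc2⟩ := Finset.mem_filter.1 hc
    obtain ⟨s, hs, he⟩ := CellTour.mem_run.1 hc2
    exact Finset.mem_biUnion.2 ⟨s, hs, Finset.mem_filter.2 ⟨hc1, he⟩⟩
  refine (Finset.card_le_card hsub).trans ((Finset.card_biUnion_le_card_mul _ _ 1 ?_).trans ?_)
  · intro s _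
    refine Finset.card_le_one.2 fun a ha b hb => ?_
    obtain ⟨ha1, ha2⟩ := Finset.mem_filter.1 ha
    obtain ⟨hb1, hb2⟩ := Finset.mem_filter.1 hb
    have h : a + s ≡ b + s [MOD M ^ 2] := τ.mod_eq_of_cell_eq hM (ha2.trans hb2.symm)
    have h' := Nat.ModEq.add_right_cancel' s h
    rw [Nat.ModEq, Nat.mod_eq_of_lt (Finset.mem_range.1 ha1),
      Nat.mod_eq_of_lt (Finset.mem_range.1 hb1)] at h'
    exact h'
  · simp

theorem emptyRunSum_nonneg (τ : CellTour M) {α : ℝ} (hα : 1 ≤ α) (L : ℕ)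
    (x : Fin n → UnitSquare) (c : ℕ) : 0 ≤ τ.emptyRunSum α L x c :=
  Finset.sum_nonneg fun l _ => by
    split_ifs
    exacts [gapCoeff_nonneg hα l, le_rfl]

theorem emptyRunSum_le (τ : CellTour M) {α : ℝ} (hα : 1 ≤ α) (L : ℕ)
    (x : Fin n → UnitSquare) (c : ℕ) : τ.emptyRunSum α L x c ≤ (L : ℝ) ^ α := by
  refine le_trans (Finset.sum_le_sum fun l _ => ?_) (sum_range_gapCoeff_le (by linarith) L)
  split_ifs
  exacts [le_rfl, gapCoeff_nonneg hα l]

/-- All runs that enter lie in the run of length `L`, which contains neither the old nor the new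
position. -/
theorem emptyRunSum_update (τ : CellTour M) (α : ℝ) {L : ℕ} {x : Fin n → UnitSquare} {i : Fin n}
    {s : UnitSquare} {c : ℕ} (h0 : gridCell M (x i) ∉ τ.run c L)
    (h1 : gridCell M s ∉ τ.run c L) :
    τ.emptyRunSum α L (Function.update x i s) c = τ.emptyRunSum α L x c := by
  refine Finset.sum_congr rfl fun l hl => ?_
  have hsub := τ.run_mono c (Finset.mem_range.1 hl).le
  have : (∀ j, gridCell M (Function.update x i s j) ∉ τ.run c l)
      ↔ ∀ j, gridCell M (x j) ∉ τ.run c l := by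
    refine forall_congr' fun j => ?_
    by_cases hj : j = i
    · subst hj
      simp only [Function.update_self]
      exact ⟨fun _ h => h0 (hsub h), fun _ h => h1 (hsub h)⟩
    · simp [hj]
  simp only [this]

/-- The old and the new position each affect at most `L` starting times, and each affected summand
lies in `[0, L ^ α]`. -/
theorem abs_gapSum_update_sub_le (τ : CellTour M) (hM : 0 < M) {α : ℝ} (hα : 1 ≤ α) (L : ℕ)
    (x : Fin n → UnitSquare) (i : Fin n) (s : UnitSquare) :
    |τ.gapSum α L (Function.update x i s) - τ.gapSum α L x| ≤ 2 * L * (L : ℝ) ^ α := by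
  have hL : (0 : ℝ) ≤ (L : ℝ) ^ α := by positivity
  have hcount : ∀ q, ∑ c ∈ Finset.range (M ^ 2), (if q ∈ τ.run c L then (L : ℝ) ^ α else 0)
      ≤ L * (L : ℝ) ^ α := fun q => by
    rw [← Finset.sum_filter, Finset.sum_const, nsmul_eq_mul]
    refine mul_le_mul_of_nonneg_right ?_ hL
    exact_mod_cast τ.card_filter_mem_run_le hM L q
  rw [CellTour.gapSum, CellTour.gapSum, ← Finset.sum_sub_distrib]
  calc _ ≤ ∑ c ∈ Finset.range (M ^ 2),
        |τ.emptyRunSum α L (Function.update x i s) c - τ.emptyRunSum α L x c| :=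
        Finset.abs_sum_le_sum_abs _ _
    _ ≤ ∑ c ∈ Finset.range (M ^ 2), ((if gridCell M (x i) ∈ τ.run c L then (L : ℝ) ^ α else 0)
          + if gridCell M s ∈ τ.run c L then (L : ℝ) ^ α else 0) := by
        refine Finset.sum_le_sum fun c _ => ?_
        have habs : |τ.emptyRunSum α L (Function.update x i s) c - τ.emptyRunSum α L x c|
            ≤ (L : ℝ) ^ α := abs_sub_le_of_nonneg_of_le (emptyRunSum_nonneg τ hα L _ c)
          (emptyRunSum_le τ hα L _ c) (emptyRunSum_nonneg τ hα L _ c) (emptyRunSum_le τ hα L _ c)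
        by_cases h0 : gridCell M (x i) ∈ τ.run c L
        · rw [if_pos h0]
          split_ifs <;> linarith
        · by_cases h1 : gridCell M s ∈ τ.run c L
          · rw [if_pos h1, if_neg h0]
            linarith
          · rw [if_neg h1, if_neg h0, emptyRunSum_update τ α h0 h1]
            simp
    _ ≤ 2 * L * (L : ℝ) ^ α := by
        rw [Finset.sum_add_distrib]
        linarith [hcount (gridCell M (x i)), hcount (gridCell M s)]

theorem emptyRunSum_eq_sum_indicator (τ : CellTour M) (α : ℝ) (L : ℕ) (x : Fin n → UnitSquare)
    (c : ℕ) : τ.emptyRunSum α L x c = ∑ l ∈ Finset.range L,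
      {x : Fin n → UnitSquare | ∀ i, gridCell M (x i) ∉ τ.run c l}.indicator
        (fun _ => gapCoeff α l) x := by
  classical
  refine Finset.sum_congr rfl fun l _ => ?_
  rw [Set.indicator_apply]
  rfl

theorem measurable_gapSum (τ : CellTour M) (α : ℝ) (L : ℕ) :
    Measurable fun x : Fin n → UnitSquare => τ.gapSum α L x := by
  simp only [CellTour.gapSum, emptyRunSum_eq_sum_indicator]
  exact Finset.measurable_sum _ fun c _ => Finset.measurable_sum _ fun l _ =>
    measurable_const.indicator (measurableSet_forall_notMem M _)

variable {ε₁ ε₂ : ℝ} {μ : Measure UnitSquare}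

/-- The `l` distinct squares have total mass at least `ε₁ * l / M ^ 2`. The parameter `r` absorbs
the rounding of `M`; it is later set to `1 - p`. -/
theorem pi_real_run_le [IsProbabilityMeasure μ] (hμ : IsBoundedLaw ε₁ ε₂ μ) (hε₁ : 0 ≤ ε₁)
    (hM : 0 < M) (τ : CellTour M) (c : ℕ) {l : ℕ} (hl : l ≤ M ^ 2) {r : ℝ}
    (hr : Real.exp (-(ε₁ * (n / (M : ℝ) ^ 2))) ≤ r) :
    (Measure.pi fun _ : Fin n => μ).real {x | ∀ i, gridCell M (x i) ∉ τ.run c l} ≤ r ^ l := by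
  have hw := hμ.le_gridCell hε₁ (τ.run_subset c l)
  rw [τ.card_run hM c hl] at hw
  rw [pi_real_forall_notMem]
  set w := μ.real (gridCell M ⁻¹' (τ.run c l))
  have hw1 : w ≤ 1 := measureReal_le_one
  calc (1 - w) ^ n ≤ Real.exp (-w) ^ n :=
        pow_le_pow_left₀ (by linarith) (by linarith [Real.add_one_le_exp (-w)]) n
    _ = Real.exp (-(n * w)) := by rw [← Real.exp_nat_mul]; ring_nf
    _ ≤ Real.exp (-(n * (ε₁ * (l / (M : ℝ) ^ 2)))) := by
        refine Real.exp_le_exp.2 (neg_le_neg ?_)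
        gcongr
    _ = Real.exp (-(ε₁ * (n / (M : ℝ) ^ 2))) ^ l := by rw [← Real.exp_nat_mul]; ring_nf
    _ ≤ r ^ l := pow_le_pow_left₀ (Real.exp_pos _).le hr l

theorem integral_gapSum_le [IsProbabilityMeasure μ] (hμ : IsBoundedLaw ε₁ ε₂ μ) (hε₁ : 0 ≤ ε₁)
    (hM : 0 < M) (τ : CellTour M) {α : ℝ} (hα : 1 ≤ α) {L : ℕ} (hL : L ≤ M ^ 2) {r : ℝ}
    (hr : Real.exp (-(ε₁ * (n / (M : ℝ) ^ 2))) ≤ r) :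
    ∫ x, τ.gapSum α L x ∂(Measure.pi fun _ : Fin n => μ)
      ≤ (M : ℝ) ^ 2 * ∑ l ∈ Finset.range L, gapCoeff α l * r ^ l := by
  have hint : ∀ c l, Integrable ({x : Fin n → UnitSquare |
      ∀ i, gridCell M (x i) ∉ τ.run c l}.indicator (fun _ => gapCoeff α l))
      (Measure.pi fun _ : Fin n => μ) := fun c l =>
    (integrable_const _).indicator (measurableSet_forall_notMem M _)
  simp only [CellTour.gapSum, emptyRunSum_eq_sum_indicator]
  rw [integral_finsetSum _ fun c _ => integrable_finsetSum _ fun l _ => hint c l]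
  calc _ ≤ ∑ _c ∈ Finset.range (M ^ 2), ∑ l ∈ Finset.range L, gapCoeff α l * r ^ l := by
        refine Finset.sum_le_sum fun c _ => ?_
        rw [integral_finsetSum _ fun l _ => hint c l]
        refine Finset.sum_le_sum fun l hl => ?_
        rw [integral_indicator_const _ (measurableSet_forall_notMem M _), smul_eq_mul, mul_comm]
        exact mul_le_mul_of_nonneg_left (pi_real_run_le hμ hε₁ hM τ c
          ((Finset.mem_range.1 hl).le.trans hL) hr) (gapCoeff_nonneg hα l)
    _ = _ := by
        rw [Finset.sum_const, Finset.card_range, nsmul_eq_mul]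
        push_cast
        ring

/-- With large probability, the minimum weight of a cycle is at most the weight of a tour along
the squares of the subdivision. -/
theorem pi_real_lt_tspWeight_le [IsProbabilityMeasure μ] (hμ : IsBoundedLaw ε₁ ε₂ μ)
    (hε₁ : 0 ≤ ε₁) (hM : 0 < M) (τ : CellTour M) {α : ℝ} (hα : 1 ≤ α) {L : ℕ}
    (hL : L ≤ M ^ 2) {r : ℝ} (hr : Real.exp (-(ε₁ * (n / (M : ℝ) ^ 2))) ≤ r)
    {c₁ c₂ : ℝ} {h : UnitSquare → UnitSquare → ℝ} (hh : IsEdgeWeight c₁ c₂ h) (hc₁ : 0 ≤ c₁)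
    (hc₂ : 0 ≤ c₂) (hn : 0 < n) {t : ℝ} (ht : 0 ≤ t) :
    (Measure.pi fun _ : Fin n => μ).real {x | (2 * c₂ / M) ^ α * (n + (3 / 2) ^ α * (M : ℝ) ^ 2
        + ((M : ℝ) ^ 2 * ∑ l ∈ Finset.range L, gapCoeff α l * r ^ l + t)) < tspWeight h α x}
      ≤ Real.exp (-t ^ 2 / (2 * (n * (2 * L * (L : ℝ) ^ α) ^ 2))) + (M : ℝ) ^ 2 * r ^ L := by
  set Q : Measure (Fin n → UnitSquare) := Measure.pi fun _ => μ
  have hbd := measure_ge_le_of_bounded_differences μ (measurable_gapSum (n := n) τ α L)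
    (B := (M : ℝ) ^ 2 * (L : ℝ) ^ α) (fun x => by
      rw [abs_of_nonneg (show 0 ≤ τ.gapSum α L x from
        Finset.sum_nonneg fun c _ => emptyRunSum_nonneg τ hα L x c)]
      refine (Finset.sum_le_sum fun c _ => emptyRunSum_le τ hα L x c).trans (le_of_eq ?_)
      rw [Finset.sum_const, Finset.card_range, nsmul_eq_mul]
      push_cast
      ring) (by positivity) (abs_gapSum_update_sub_le τ hM hα L) ht
  -- Union bound over the starting times of empty runs of full length `L`. Outside this event no gap
  -- exceeds `L`, and the deterministic bound applies.
  have hrun : Q.real (⋃ c ∈ Finset.range (M ^ 2), {x | ∀ i, gridCell M (x i) ∉ τ.run c L})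
      ≤ (M : ℝ) ^ 2 * r ^ L := by
    refine (measureReal_biUnion_finset_le _ _).trans ?_
    refine (Finset.sum_le_sum fun c _ => pi_real_run_le hμ hε₁ hM τ c hL hr).trans (le_of_eq ?_)
    rw [Finset.sum_const, Finset.card_range, nsmul_eq_mul]
    push_cast
    ring
  refine le_trans (measureReal_mono (fun x hx => ?_)) ((measureReal_union_le _ _).trans
    (add_le_add hbd hrun))
  by_contra hcon
  simp only [Set.mem_union, Set.mem_ofPred_eq, Set.mem_iUnion, not_or, not_exists, not_forall,
    not_not, not_le, Finset.mem_range] at hcon hx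
  obtain ⟨h1, h2⟩ := hcon
  refine absurd (tspWeight_le_of_run hh hc₁ hc₂ hα hM τ hn (L := L) (x := x)
    fun c hc => h2 c hc) (not_le.2 (lt_of_le_of_lt ?_ hx))
  have h3 := integral_gapSum_le (n := n) hμ hε₁ hM τ hα hL hr
  refine mul_le_mul_of_nonneg_left ?_ (by positivity)
  linarith

end GapSum

/-! ### The series of second differences and the moments of geometric variables. -/

section GeometricMoments

/-- Summation by parts: taking differences multiplies the generating function by `1 - r`. -/
theorem hasSum_diffSeq_mul_pow {b : ℕ → ℝ} {r s : ℝ} (hb : HasSum (fun j => b j * r ^ j) s) :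
    HasSum (fun j => diffSeq b j * r ^ j) ((1 - r) * s) := by
  have h1 : HasSum (fun j => if j = 0 then 0 else b (j - 1) * r ^ j) (r * s) := by
    rw [← hasSum_nat_add_iff' 1]
    simp only [Finset.range_one, Finset.sum_singleton, if_true, sub_zero]
    refine (hb.mul_left r).congr_fun fun j => ?_
    rw [if_neg (Nat.succ_ne_zero j), Nat.add_sub_cancel]
    ring
  have h2 := hb.sub h1
  rw [show (1 - r) * s = s - r * s by ring]
  refine h2.congr_fun fun j => ?_
  rcases j with _ | j
  · simp [diffSeq]
  · rw [if_neg (Nat.succ_ne_zero j), Nat.add_sub_cancel, diffSeq]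
    ring

/-- The series of `(j + 1) ^ α * (1 - p) ^ j` is `geomMoment p α / p`; two differences multiply it
by `p ^ 2`. -/
theorem sum_gapCoeff_mul_pow_le {p α : ℝ} (hp : 0 < p) (hp1 : p < 1) (hα : 1 ≤ α) (L : ℕ) :
    ∑ l ∈ Finset.range L, gapCoeff α l * (1 - p) ^ l ≤ p * geomMoment p α := by
  have h0 : HasSum (fun j : ℕ => (1 - p) ^ j * p * ((j : ℝ) + 1) ^ α) (geomMoment p α) :=
    (summable_geomMoment hp hp1 α).hasSum
  have h1 : HasSum (fun j : ℕ => ((j : ℝ) + 1) ^ α * (1 - p) ^ j) (p⁻¹ * geomMoment p α) := by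
    refine (h0.mul_left p⁻¹).congr_fun fun j => ?_
    field_simp
  have h2 := hasSum_diffSeq_mul_pow (hasSum_diffSeq_mul_pow h1)
  have h3 : (1 - (1 - p)) * ((1 - (1 - p)) * (p⁻¹ * geomMoment p α)) = p * geomMoment p α := by
    field_simp
    ring
  rw [h3] at h2
  exact sum_le_hasSum _ (fun l _ => mul_nonneg (gapCoeff_nonneg hα l)
    (pow_nonneg (by linarith) l)) h2

/-- The value `1` has probability `p` and contributes `1 ^ α`; the other values carry mass `1 - p`.
-/
theorem le_geomMoment {p α B : ℝ} (hp : 0 < p) (hp1 : p < 1)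
    (hB : ∀ j : ℕ, B ≤ ((j : ℝ) + 2) ^ α) : p + (1 - p) * B ≤ geomMoment p α := by
  have h0 := summable_geomMoment hp hp1 α
  have hg : HasSum (fun j : ℕ => (1 - p) ^ j) p⁻¹ := by
    have := hasSum_geometric_of_lt_one (r := 1 - p) (by linarith) (by linarith)
    rwa [sub_sub_cancel] at this
  have h1 : HasSum (fun j : ℕ => (1 - p) ^ (j + 1) * p * B) ((1 - p) * B) := by
    have h2 := hg.mul_left ((1 - p) * p * B)
    have h3 : (1 - p) * p * B * p⁻¹ = (1 - p) * B := by field_simp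
    rw [h3] at h2
    refine h2.congr_fun fun j => ?_
    ring
  rw [geomMoment, h0.tsum_eq_zero_add]
  simp only [pow_zero, one_mul, Nat.cast_zero, zero_add, Real.one_rpow, mul_one]
  refine add_le_add le_rfl ?_
  rw [← h1.tsum_eq]
  refine h1.summable.tsum_le_tsum (fun j => ?_) ((summable_nat_add_iff 1).2 h0)
  refine mul_le_mul_of_nonneg_left ?_ (mul_nonneg (pow_nonneg (by linarith) _) hp.le)
  have := hB j
  push_cast
  rwa [add_assoc, one_add_one_eq_two]

theorem one_le_geomMoment {p α : ℝ} (hp : 0 < p) (hp1 : p < 1) (hα : 0 ≤ α) :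
    1 ≤ geomMoment p α := by
  have := le_geomMoment (α := α) (B := 1) hp hp1 fun j =>
    Real.one_le_rpow (by linarith [j.cast_nonneg (α := ℝ)]) hα
  linarith

/-- This fits the linear and the power part of the gaps into the constant of `upperConst`. By
`le_geomMoment` with `B = 2 ^ α`, the quantity `(1 - p) * geomMoment p α + geomMoment (1 - p) α` is
at least `((1 - p) ^ 2 + p) * 2 ^ α`, and `(1 - p) ^ 2 + p = 3 / 4 + (p - 1 / 2) ^ 2`. -/
theorem add_mul_geomMoment_le {p α : ℝ} (hp : 0 < p) (hp1 : p < 1) (hα : 1 ≤ α) :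
    (3 / 2) ^ α + p * geomMoment p α ≤ geomMoment p α + geomMoment (1 - p) α := by
  have hB : ∀ j : ℕ, (2 : ℝ) ^ α ≤ ((j : ℝ) + 2) ^ α := fun j =>
    Real.rpow_le_rpow (by norm_num) (by linarith [j.cast_nonneg (α := ℝ)]) (by linarith)
  have h1 := le_geomMoment hp hp1 hB
  have h2 := le_geomMoment (p := 1 - p) (by linarith) (by linarith) hB
  have h3 : ((3 : ℝ) / 2) ^ α ≤ 3 / 4 * 2 ^ α := by
    have h4 : ((3 : ℝ) / 4) ^ α ≤ (3 / 4) ^ (1 : ℝ) :=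
      Real.rpow_le_rpow_of_exponent_ge (by norm_num) (by norm_num) hα
    rw [Real.rpow_one] at h4
    calc ((3 : ℝ) / 2) ^ α = (3 / 4) ^ α * 2 ^ α := by
          rw [← Real.mul_rpow (by norm_num) (by norm_num)]
          norm_num
      _ ≤ _ := mul_le_mul_of_nonneg_right h4 (by positivity)
  have h5 : (0 : ℝ) ≤ 2 ^ α := by positivity
  have h6 : (1 - p) * (p + (1 - p) * 2 ^ α) ≤ (1 - p) * geomMoment p α :=
    mul_le_mul_of_nonneg_left h1 (by linarith)
  nlinarith [mul_nonneg (sq_nonneg (p - 1 / 2)) h5]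

end GeometricMoments

/-! ### The lower tail bound for large `n`. -/

section LowerAsymptotics

open Filter Topology

theorem tendsto_natCast_rpow_atTop {a : ℝ} (ha : 0 < a) :
    Tendsto (fun n : ℕ => (n : ℝ) ^ a) atTop atTop :=
  (tendsto_rpow_atTop ha).comp tendsto_natCast_atTop_atTop

theorem tendsto_div_natCast_rpow {a : ℝ} (ha : 0 < a) (c : ℝ) :
    Tendsto (fun n : ℕ => c / (n : ℝ) ^ a) atTop (𝓝 0) :=
  (tendsto_natCast_rpow_atTop ha).const_div_atTop c

theorem eventually_mul_rpow_le_rpow {a b : ℝ} (hab : a < b) (C : ℝ) :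
    ∀ᶠ n : ℕ in atTop, C * (n : ℝ) ^ a ≤ (n : ℝ) ^ b := by
  filter_upwards [(tendsto_natCast_rpow_atTop (sub_pos.2 hab)).eventually_ge_atTop C,
    eventually_gt_atTop 0] with n h1 h2
  have hn : (0 : ℝ) < n := by exact_mod_cast h2
  calc C * (n : ℝ) ^ a ≤ (n : ℝ) ^ (b - a) * (n : ℝ) ^ a := by gcongr
    _ = (n : ℝ) ^ b := by rw [← Real.rpow_add hn, sub_add_cancel]

theorem exp_neg_div_le_one_sub {u : ℝ} (hu : u < 1) : Real.exp (-(u / (1 - u))) ≤ 1 - u := by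
  have h1 : 0 < 1 - u := by linarith
  have h2 := Real.add_one_le_exp (u / (1 - u))
  have h3 : u / (1 - u) + 1 = (1 - u)⁻¹ := by field_simp; ring
  rw [h3] at h2
  rw [Real.exp_neg]
  exact inv_le_of_inv_le₀ h1 h2

/-- The mean number of isolated squares, up to a relative error of the order of the side `1 / M`
of the squares. -/
theorem le_mean_isolatedCells {A ε₁ ε₂ : ℝ} (hA : 0 < A) (hε₁ : 0 < ε₁) (hε₂ : 0 < ε₂)
    {n M : ℕ} {y : ℝ} (hy : 0 < y) (hy1 : y ≤ 1) (hny : (n : ℝ) * y ^ 2 = A ^ 2)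
    (hM1 : M * y ≤ 1) (hM2 : 1 - y ≤ M * y) (hR : (2 + 8 * ε₂) * y ≤ 1 / 2)
    (hK : 16 * ε₂ * A ^ 2 * (2 + 8 * ε₂) * y ≤ 1) :
    8 * ε₂ / (M : ℝ) ^ 2 ≤ 1 ∧
    n / A ^ 2 * ((1 - Real.exp (-(ε₁ * A ^ 2))) * Real.exp (-(8 * ε₂ * A ^ 2)))
        * (1 - (16 * ε₂ * A ^ 2 * (2 + 8 * ε₂) + 2) * y)
      ≤ (M : ℝ) ^ 2 * ((1 - 8 * ε₂ / (M : ℝ) ^ 2) ^ n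
        * (1 - Real.exp (-(ε₁ * (n / (M : ℝ) ^ 2))))) := by
  -- Here `y` is the ideal side `A / √n`. `R * y` bounds the relative loss in `M ^ 2 - 8 * ε₂`
  -- against `1 / y ^ 2`, and `K * y` the resulting error in the exponent `8 * ε₂ * A ^ 2`.
  set R := 2 + 8 * ε₂ with hRdef
  set K := 16 * ε₂ * A ^ 2 * R with hKdef
  have hRpos : 0 < R := by positivity
  have hKpos : 0 < K := by positivity
  have hsq : (1 - y) ^ 2 ≤ (M * y) ^ 2 := pow_le_pow_left₀ (by linarith) hM2 2
  have hRy : R * y = 2 * y + 8 * (ε₂ * y) := by rw [hRdef]; ring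
  have hy4 : y ≤ 1 / 4 := by linarith [mul_pos hε₂ hy]
  have hm1 : 1 - 2 * y ≤ (M : ℝ) ^ 2 * y ^ 2 := by
    rw [← mul_pow]
    linarith [sq_nonneg y]
  have hm2 : (M : ℝ) ^ 2 * y ^ 2 ≤ 1 := by
    rw [← mul_pow]
    exact pow_le_one₀ (by positivity) hM1
  have hden : 1 - R * y ≤ (M : ℝ) ^ 2 * y ^ 2 - 8 * ε₂ * y ^ 2 := by
    have h1 : ε₂ * y ^ 2 ≤ ε₂ * y := by
      refine mul_le_mul_of_nonneg_left ?_ hε₂.le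
      rw [sq]
      exact mul_le_of_le_one_left hy.le hy1
    linarith
  have hdpos : 0 < (M : ℝ) ^ 2 * y ^ 2 - 8 * ε₂ * y ^ 2 := by linarith
  have hMpos : 0 < (M : ℝ) ^ 2 := by
    have : 0 < (M : ℝ) ^ 2 * y ^ 2 := by linarith
    exact pos_of_mul_pos_left this (by positivity)
  have hMε : 0 < (M : ℝ) ^ 2 - 8 * ε₂ := by
    have : 0 < ((M : ℝ) ^ 2 - 8 * ε₂) * y ^ 2 := by linarith
    exact pos_of_mul_pos_left this (by positivity)
  have hnA : (n : ℝ) = A ^ 2 / y ^ 2 := by field_simp; linarith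
  have hexp : Real.exp (-(8 * ε₂ * A ^ 2)) * (1 - K * y) ≤ (1 - 8 * ε₂ / (M : ℝ) ^ 2) ^ n := by
    have hu : 8 * ε₂ / (M : ℝ) ^ 2 < 1 := by rw [div_lt_one hMpos]; linarith
    have h1 := pow_le_pow_left₀ (Real.exp_pos _).le (exp_neg_div_le_one_sub hu) n
    refine le_trans ?_ h1
    rw [← Real.exp_nat_mul]
    have h2 : 8 * ε₂ / (M : ℝ) ^ 2 / (1 - 8 * ε₂ / (M : ℝ) ^ 2)
        = 8 * ε₂ / ((M : ℝ) ^ 2 - 8 * ε₂) := by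
      rw [one_sub_div hMpos.ne', div_div_div_cancel_right₀ hMpos.ne']
    have h3 : (n : ℝ) * (8 * ε₂ / ((M : ℝ) ^ 2 - 8 * ε₂))
        = 8 * ε₂ * A ^ 2 / ((M : ℝ) ^ 2 * y ^ 2 - 8 * ε₂ * y ^ 2) := by
      rw [← hny]
      field_simp
    have h4 : 8 * ε₂ * A ^ 2 / ((M : ℝ) ^ 2 * y ^ 2 - 8 * ε₂ * y ^ 2)
        ≤ 8 * ε₂ * A ^ 2 * (1 + 2 * (R * y)) := by
      rw [div_le_iff₀ hdpos, mul_assoc (8 * ε₂ * A ^ 2)]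
      refine le_mul_of_one_le_right (by positivity : 0 ≤ 8 * ε₂ * A ^ 2) ?_
      have h5 : 1 ≤ (1 + 2 * (R * y)) * (1 - R * y) := by
        have hw := mul_nonneg (mul_pos hRpos hy).le (sub_nonneg.2 hR)
        linarith
      exact h5.trans (mul_le_mul_of_nonneg_left hden (by positivity))
    calc Real.exp (-(8 * ε₂ * A ^ 2)) * (1 - K * y)
        ≤ Real.exp (-(8 * ε₂ * A ^ 2)) * Real.exp (-(K * y)) := by
          refine mul_le_mul_of_nonneg_left ?_ (Real.exp_pos _).le
          linarith [Real.add_one_le_exp (-(K * y))]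
      _ = Real.exp (-(8 * ε₂ * A ^ 2 * (1 + 2 * (R * y)))) := by
          rw [← Real.exp_add]
          congr 1
          simp only [hKdef]
          ring
      _ ≤ _ := by
          refine Real.exp_le_exp.2 ?_
          rw [h2, mul_neg, h3]
          exact neg_le_neg h4
  have hexp1 : 1 - Real.exp (-(ε₁ * A ^ 2)) ≤ 1 - Real.exp (-(ε₁ * (n / (M : ℝ) ^ 2))) := by
    refine sub_le_sub_left (Real.exp_le_exp.2 (neg_le_neg ?_)) 1
    refine mul_le_mul_of_nonneg_left ?_ hε₁.le
    rw [le_div_iff₀ hMpos, ← hny, mul_assoc]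
    refine mul_le_of_le_one_right n.cast_nonneg (by linarith)
  have hD1 : 0 ≤ 1 - Real.exp (-(ε₁ * A ^ 2)) :=
    sub_nonneg.2 (Real.exp_le_one_iff.2 (neg_nonpos.2 (by positivity)))
  have hM' : n / A ^ 2 * (1 - 2 * y) ≤ (M : ℝ) ^ 2 := by
    have h6 : (n : ℝ) / A ^ 2 = 1 / y ^ 2 := by rw [hnA]; field_simp
    rw [h6, div_mul_eq_mul_div, one_mul, div_le_iff₀ (by positivity)]
    exact hm1
  have hKy : 0 ≤ 1 - K * y := by linarith
  have hy2 : 2 * y ≤ 1 := by linarith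
  refine ⟨by rw [div_le_one hMpos]; linarith, ?_⟩
  calc n / A ^ 2 * ((1 - Real.exp (-(ε₁ * A ^ 2))) * Real.exp (-(8 * ε₂ * A ^ 2)))
        * (1 - (K + 2) * y)
      ≤ n / A ^ 2 * ((1 - Real.exp (-(ε₁ * A ^ 2))) * Real.exp (-(8 * ε₂ * A ^ 2)))
        * ((1 - 2 * y) * (1 - K * y)) := by
        refine mul_le_mul_of_nonneg_left ?_ (by positivity)
        have : 0 ≤ K * y * y := by positivity
        linarith
    _ = (n / A ^ 2 * (1 - 2 * y)) * ((Real.exp (-(8 * ε₂ * A ^ 2)) * (1 - K * y))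
        * (1 - Real.exp (-(ε₁ * A ^ 2)))) := by ring
    _ ≤ _ := by
        refine mul_le_mul hM' (mul_le_mul hexp hexp1 hD1 ?_) ?_ hMpos.le
        · exact le_trans (by positivity) hexp
        · positivity

theorem eventually_le_pi_real_le_tspWeight {α : ℝ} (hα : 0 < α) {ε₁ ε₂ : ℝ} (hε₁ : 0 < ε₁)
    (hε₂ : 0 < ε₂) {c₁ c₂ : ℝ} (hc₁ : 0 < c₁) {A : ℝ} (hA : 0 < A) :
    ∀ᶠ n : ℕ in atTop, ∀ (μ : Measure UnitSquare) (h : UnitSquare → UnitSquare → ℝ),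
      IsBoundedLaw ε₁ ε₂ μ → IsEdgeWeight c₁ c₂ h →
      1 - Real.exp (-((n : ℝ) ^ (1 / 3 : ℝ))) ≤ (Measure.pi fun _ : Fin n => μ).real
        {x | lowerConst c₁ ε₁ ε₂ α A * (n : ℝ) ^ (1 - α / 2)
          * (1 - 4 * √A / (n : ℝ) ^ (1 / 4 : ℝ)) ≤ tspWeight h α x} := by
  set D := (1 - Real.exp (-(ε₁ * A ^ 2))) * Real.exp (-(8 * ε₂ * A ^ 2)) with hD
  set K := 16 * ε₂ * A ^ 2 * (2 + 8 * ε₂) with hKdef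
  have hDpos : 0 < D := by
    refine mul_pos (sub_pos.2 (Real.exp_lt_one_iff.2 (neg_lt_zero.2 (by positivity)))) (Real.exp_pos _)
  have hKpos : 0 < K := by positivity
  have hz0 := tendsto_div_natCast_rpow (a := 1 / 4) (by norm_num) √A
  have hsmall : ∀ δ : ℝ, 0 < δ → ∀ᶠ n : ℕ in atTop, √A / (n : ℝ) ^ (1 / 4 : ℝ) ≤ δ :=
    fun δ hδ => hz0.eventually_le_const hδ
  filter_upwards [eventually_gt_atTop 0, hsmall (1 / 4) (by norm_num),
    hsmall (1 / (K + 2)) (by positivity),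
    hsmall (1 / (2 * (2 + 8 * ε₂))) (by positivity),
    -- The factor `648 = 2 * 18 ^ 2` comes from McDiarmid's inequality with difference bound 18.
    eventually_mul_rpow_le_rpow (a := 1 / 3) (b := 1 / 2) (by norm_num) (648 * A ^ 3 / D ^ 2),
    tendsto_natCast_atTop_atTop.eventually_ge_atTop (4 * A ^ 2 / D)]
    with n hn0 hz1 hz2 hz3 hn1 hn2 μ h hμ hh
  have hprob := hμ.isProbabilityMeasure
  have hn : (0 : ℝ) < n := by exact_mod_cast hn0
  set z := √A / (n : ℝ) ^ (1 / 4 : ℝ) with hz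
  have hzpos : 0 < z := by positivity
  have hzsq : z ^ 2 = A / √n := by
    rw [hz, div_pow, Real.sq_sqrt hA.le, ← Real.rpow_natCast, ← Real.rpow_mul hn.le,
      Real.sqrt_eq_rpow]
    norm_num
  -- The allowed relative error `z` is the square root of the ideal side `y = A / √n`; errors of
  -- order `y` are therefore below `z` for large `n`.
  set y := z ^ 2 with hy
  have hypos : 0 < y := by positivity
  have hyz : y ≤ z := by
    rw [hy, sq]
    exact mul_le_of_le_one_left hzpos.le (by linarith)
  have hny : (n : ℝ) * y ^ 2 = A ^ 2 := by
    rw [hzsq, div_pow, Real.sq_sqrt hn.le]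
    field_simp
  set M := ⌊1 / y⌋₊ with hM
  have hM1 : M * y ≤ 1 := by
    rw [← le_div_iff₀ hypos]
    exact Nat.floor_le (by positivity)
  have hM2 : 1 - y ≤ M * y := by
    have := (Nat.lt_floor_add_one (1 / y)).le
    rw [div_le_iff₀ hypos] at this
    linarith
  have hR : (2 + 8 * ε₂) * y ≤ 1 / 2 := by
    rw [le_div_iff₀ (by positivity)] at hz3
    have := mul_le_mul_of_nonneg_left hyz (by positivity : 0 ≤ 2 + 8 * ε₂)
    linarith
  have hKz : (K + 2) * z ≤ 1 := by
    rw [le_div_iff₀ (by positivity)] at hz2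
    linarith
  obtain ⟨hM8, hmean⟩ := le_mean_isolatedCells hA hε₁ hε₂ (n := n) hypos (by linarith) hny hM1 hM2 hR
    (by linarith [mul_le_mul_of_nonneg_left hyz hKpos.le])
  rw [← hKdef, ← hD] at hmean
  have hMpos : 0 < M := by
    have : (0 : ℝ) < M := pos_of_mul_pos_left (by linarith : 0 < M * y) hypos.le
    exact_mod_cast this
  have hMpos' : (0 : ℝ) < M := by exact_mod_cast hMpos
  -- A deviation of relative size `z` has exponent of order `n * z ^ 2`, that is `√n`, which exceeds
  -- `n ^ (1 / 3)`. Together with the loss `(K + 2) * y ≤ z` in the mean it costs `2 * z`.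
  set t := n / A ^ 2 * D * z with ht
  have htpos : 0 < t := by positivity
  have hprobability := pi_real_card_isolatedCells_le (n := n) hμ hε₁.le hε₂.le hMpos hM8 htpos.le
  set E := (M : ℝ) ^ 2 * ((1 - 8 * ε₂ / (M : ℝ) ^ 2) ^ n
    * (1 - Real.exp (-(ε₁ * (n / (M : ℝ) ^ 2))))) with hE
  have hEt : n / A ^ 2 * D * (1 - 2 * z) ≤ E - t := by
    have h1 : n / A ^ 2 * D * (1 - z) ≤ n / A ^ 2 * D * (1 - (K + 2) * y) := by
      refine mul_le_mul_of_nonneg_left ?_ (by positivity)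
      have := mul_le_mul_of_nonneg_right hKz hzpos.le
      rw [hy]
      linarith
    linarith
  have hexp : Real.exp (-t ^ 2 / (2 * (n * 18 ^ 2))) ≤ Real.exp (-((n : ℝ) ^ (1 / 3 : ℝ))) := by
    refine Real.exp_le_exp.2 ?_
    rw [neg_div]
    refine neg_le_neg ?_
    have h1 : t ^ 2 / (2 * (n * 18 ^ 2)) = (n : ℝ) ^ (1 / 2 : ℝ) * (D ^ 2 / (648 * A ^ 3)) := by
      have h2 : t ^ 2 = (n / A ^ 2 * D) ^ 2 * y := by rw [ht, hy]; ring
      rw [h2, hzsq, ← Real.sqrt_eq_rpow]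
      have h3 : √(n : ℝ) ≠ 0 := by positivity
      field_simp
      rw [Real.sq_sqrt hn.le]
      ring
    rw [h1, ← div_le_iff₀ (by positivity)]
    refine le_trans (le_of_eq ?_) hn1
    field_simp
  -- Ensures the two isolated squares that the deterministic bound needs.
  have hlarge : 2 ≤ n / A ^ 2 * D * (1 - 2 * z) := by
    have h1 : 4 ≤ n / A ^ 2 * D := by
      rw [div_le_iff₀ hDpos] at hn2
      rw [div_mul_eq_mul_div, le_div_iff₀ (by positivity)]
      exact hn2
    have := mul_le_mul h1 (by linarith : (1 : ℝ) / 2 ≤ 1 - 2 * z) (by norm_num) (by positivity)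
    linarith
  have hsub : {x : Fin n → UnitSquare | ((isolatedCells M x).card : ℝ) ≤ E - t}ᶜ
      ⊆ {x | lowerConst c₁ ε₁ ε₂ α A * (n : ℝ) ^ (1 - α / 2)
          * (1 - 4 * √A / (n : ℝ) ^ (1 / 4 : ℝ)) ≤ tspWeight h α x} := by
    intro x hx
    simp only [Set.mem_compl_iff, Set.mem_ofPred_eq, not_le] at hx ⊢
    have hcard : n / A ^ 2 * D * (1 - 2 * z) ≤ (isolatedCells M x).card := by linarith
    have h2 : 2 ≤ (isolatedCells M x).card := by exact_mod_cast hlarge.trans hcard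
    refine le_trans ?_ (card_isolatedCells_mul_le_tspWeight hh hc₁.le hα.le hMpos x h2)
    have hside : c₁ * A / √n ≤ c₁ * (1 / M) := by
      rw [mul_div_assoc, ← hzsq]
      refine mul_le_mul_of_nonneg_left ?_ hc₁.le
      rw [le_div_iff₀ hMpos', mul_comm]
      exact hM1
    have hpow : (c₁ * A / √n) ^ α = (c₁ * A) ^ α / (n : ℝ) ^ (α / 2) := by
      rw [Real.div_rpow (by positivity) (by positivity), Real.sqrt_eq_rpow,
        ← Real.rpow_mul hn.le]
      ring_nf
    have h4z : 4 * √A / (n : ℝ) ^ (1 / 4 : ℝ) = 4 * z := by rw [hz, mul_div_assoc]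
    calc lowerConst c₁ ε₁ ε₂ α A * (n : ℝ) ^ (1 - α / 2) * (1 - 4 * √A / (n : ℝ) ^ (1 / 4 : ℝ))
        = n / A ^ 2 * D * (c₁ * A / √n) ^ α * (1 - 4 * z) := by
          rw [h4z, hpow, lowerConst, Real.rpow_sub hn, Real.rpow_one, hD]
          ring
      _ ≤ n / A ^ 2 * D * (c₁ * A / √n) ^ α * (1 - 2 * z) := by
          refine mul_le_mul_of_nonneg_left (by linarith) (by positivity)
      _ = n / A ^ 2 * D * (1 - 2 * z) * (c₁ * A / √n) ^ α := by ring
      _ ≤ (isolatedCells M x).card * (c₁ * (1 / M)) ^ α := by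
          refine mul_le_mul hcard (Real.rpow_le_rpow (by positivity) hside hα.le) (by positivity)
            (Nat.cast_nonneg _)
  refine le_trans ?_ (measureReal_mono hsub)
  rw [probReal_compl_eq_one_sub
    (measurableSet_le (measurable_card_isolatedCells hMpos) measurable_const)]
  linarith

end LowerAsymptotics

/-! ### The upper tail bound for large `n`. -/

section UpperAsymptotics

open Filter Topology

theorem eventually_mul_rpow_mul_exp_le {κ η : ℝ} (hκ : 0 < κ) (hη : 0 < η) (C b : ℝ) {δ : ℝ}
    (hδ : 0 < δ) :
    ∀ᶠ n : ℕ in atTop, C * ((n : ℝ) ^ b * Real.exp (-κ * (n : ℝ) ^ η)) ≤ δ := by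
  have h1 := ((tendsto_rpow_mul_exp_neg_mul_atTop_nhds_zero (b / η) κ hκ).comp
    (tendsto_natCast_rpow_atTop hη)).const_mul C
  rw [mul_zero] at h1
  filter_upwards [h1.eventually_le_const hδ] with n hn
  simp only [Function.comp_apply] at hn
  rwa [← Real.rpow_mul n.cast_nonneg, mul_div_cancel₀ _ hη.ne'] at hn

theorem deltaParam_pos {ε₁ ε₂ α : ℝ} (hε₁ : 0 < ε₁) (hε₂ : 0 < ε₂) :
    0 < deltaParam ε₁ ε₂ α := by
  unfold deltaParam
  split_ifs <;> assumption

/-- Both geometric moments are at least `1`, so it suffices that `(3 / (2 * A)) ^ α ≤ 1 + 2 / A ^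
2`. If the base exceeds `1`, its power is at most the base and the claim is a quadratic inequality
in `A`. -/
theorem rpow_le_upperConst {α : ℝ} (hα : 0 < α) (hα1 : α ≤ 1) {ε₁ ε₂ : ℝ} (hε₁ : 0 < ε₁)
    (hε₂ : 0 < ε₂) {c₂ : ℝ} (hc₂ : 0 < c₂) {A : ℝ} (hA : 0 < A) :
    (3 * c₂) ^ α ≤ upperConst c₂ ε₁ ε₂ α A := by
  have hδ := deltaParam_pos (α := α) hε₁ hε₂
  set p := denseProb (deltaParam ε₁ ε₂ α) A
  have hp : 0 < p := denseProb_pos hδ hA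
  have hp1 : p < 1 := denseProb_lt_one hδ
  have h1 := one_le_geomMoment hp hp1 hα.le
  have h2 := one_le_geomMoment (p := 1 - p) (by linarith) (by linarith) hα.le
  have h3 : (3 / (2 * A)) ^ α ≤ 1 + 1 / A ^ 2 * (geomMoment p α + geomMoment (1 - p) α) := by
    have h4 : 1 + 1 / A ^ 2 * 2 ≤ 1 + 1 / A ^ 2 * (geomMoment p α + geomMoment (1 - p) α) := by
      have : 2 ≤ geomMoment p α + geomMoment (1 - p) α := by linarith
      gcongr
    refine le_trans ?_ h4
    have h5 : 0 < 1 / A ^ 2 := by positivity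
    rcases le_total (3 / (2 * A)) 1 with h | h
    · exact (Real.rpow_le_one (by positivity) h hα.le).trans (by linarith)
    · refine (Real.rpow_le_rpow_of_exponent_le h hα1).trans ?_
      rw [Real.rpow_one, div_le_iff₀ (by positivity)]
      field_simp
      nlinarith [sq_nonneg (A - 3 / 4)]
  rw [upperConst]
  calc (3 * c₂) ^ α = (2 * c₂ * A) ^ α * (3 / (2 * A)) ^ α := by
        rw [← Real.mul_rpow (by positivity) (by positivity)]
        congr 1
        field_simp
    _ ≤ _ := mul_le_mul_of_nonneg_left h3 (by positivity)

/-- An even number of squares per side, of side at most `1 / R`. -/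
theorem exists_even_side {R : ℝ} (hR : 0 < R) :
    ∃ M : ℕ, 0 < M ∧ Nonempty (CellTour M) ∧ R ≤ M ∧ (M : ℝ) ≤ R + 2 := by
  refine ⟨2 * ⌈R / 2⌉₊, ?_, nonempty_cellTour ?_ ?_, ?_, ?_⟩
  · have := Nat.ceil_pos.2 (by positivity : 0 < R / 2)
    omega
  · have := Nat.ceil_pos.2 (by positivity : 0 < R / 2)
    omega
  · omega
  · push_cast
    linarith [Nat.le_ceil (R / 2)]
  · push_cast
    linarith [Nat.ceil_lt_add_one (by positivity : 0 ≤ R / 2)]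

/-- The side is taken near `1 / √n`, independent of `A`; then `(2 n + M ^ 2) / M ≤ 3 √n + 2`. The
parameter `A` enters only through `rpow_le_upperConst`. -/
theorem eventually_tspWeight_le_of_le_one {α : ℝ} (hα : 0 < α) (hα1 : α ≤ 1) {ε₁ ε₂ : ℝ}
    (hε₁ : 0 < ε₁) (hε₂ : 0 < ε₂) {c₁ c₂ : ℝ} (hc₁ : 0 < c₁) (hc₂ : 0 < c₂) {A : ℝ}
    (hA : 0 < A) :
    ∀ᶠ n : ℕ in atTop, ∀ (h : UnitSquare → UnitSquare → ℝ) (x : Fin n → UnitSquare),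
      IsEdgeWeight c₁ c₂ h →
      tspWeight h α x ≤ upperConst c₂ ε₁ ε₂ α A * (n : ℝ) ^ (1 - α / 2)
        * (1 + 2 / (n : ℝ) ^ (1 / 16 : ℝ)) := by
  filter_upwards [eventually_ge_atTop 1] with n hn1 h x hh
  have hn : (0 : ℝ) < n := by exact_mod_cast hn1
  have hn' : (1 : ℝ) ≤ n := by exact_mod_cast hn1
  have hs : 0 < √(n : ℝ) := Real.sqrt_pos.2 hn
  have hss : √(n : ℝ) * √n = n := Real.mul_self_sqrt hn.le
  obtain ⟨M, hM, ⟨τ⟩, hM1, hM2⟩ := exists_even_side hs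
  have hM' : (0 : ℝ) < M := by exact_mod_cast hM
  refine (tspWeight_le_of_le_one hh hc₁.le hc₂.le hα hα1 hM τ hn1 x).trans ?_
  have h1 : (2 * n + (M : ℝ) ^ 2) / M ≤ 3 * √n + 2 := by
    have h2 : 2 * (n : ℝ) / M ≤ 2 * √n := by
      rw [div_le_iff₀ hM']
      have := mul_le_mul_of_nonneg_left hM1 hs.le
      linarith
    have h3 : (2 * n + (M : ℝ) ^ 2) / M = 2 * n / M + M := by field_simp
    rw [h3]
    linarith
  have h4 : c₂ * ((2 * n + (M : ℝ) ^ 2) / M) / n ≤ 3 * c₂ * (1 + 2 / √n) / √n := by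
    have h5 : 3 * c₂ * (1 + 2 / √n) / √n = c₂ * (3 * √n + 6) / n := by
      field_simp
      rw [Real.sq_sqrt hn.le]
      ring
    rw [h5]
    have : c₂ * ((2 * n + (M : ℝ) ^ 2) / M) ≤ c₂ * (3 * √n + 6) :=
      mul_le_mul_of_nonneg_left (by linarith) hc₂.le
    gcongr
  have h6 : (1 + 2 / √(n : ℝ)) ^ α ≤ 1 + 2 / (n : ℝ) ^ (1 / 16 : ℝ) := by
    have h7 : 1 ≤ 1 + 2 / √(n : ℝ) := by
      have : 0 < 2 / √(n : ℝ) := by positivity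
      linarith
    refine (Real.rpow_le_rpow_of_exponent_le h7 hα1).trans ?_
    rw [Real.rpow_one, Real.sqrt_eq_rpow]
    have : (n : ℝ) ^ (1 / 16 : ℝ) ≤ (n : ℝ) ^ (1 / 2 : ℝ) :=
      Real.rpow_le_rpow_of_exponent_le hn' (by norm_num)
    gcongr
  calc (n : ℝ) * (c₂ * ((2 * n + (M : ℝ) ^ 2) / M) / n) ^ α
      ≤ n * (3 * c₂ * (1 + 2 / √n) / √n) ^ α := by
        refine mul_le_mul_of_nonneg_left ?_ hn.le
        exact Real.rpow_le_rpow (by positivity) h4 hα.le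
    _ = (3 * c₂) ^ α * (n : ℝ) ^ (1 - α / 2) * (1 + 2 / √(n : ℝ)) ^ α := by
        rw [Real.div_rpow (by positivity) (by positivity),
          Real.mul_rpow (by positivity) (by positivity), Real.rpow_sub hn, Real.rpow_one]
        nth_rewrite 2 [Real.sqrt_eq_rpow]
        rw [← Real.rpow_mul hn.le]
        ring_nf
    _ ≤ _ := by
        refine mul_le_mul (mul_le_mul_of_nonneg_right
          (rpow_le_upperConst hα hα1 hε₁ hε₂ hc₂ hA) (by positivity)) h6 (by positivity) ?_
        refine mul_nonneg (le_trans (by positivity)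
          (rpow_le_upperConst hα hα1 hε₁ hε₂ hc₂ hA)) (by positivity)

/-- Compared with `denseProb`, slightly larger squares still are occupied often enough. -/
theorem exp_neg_le_one_sub_denseProb {ε A y q : ℝ} (hε : 0 < ε) (hA : 0 < A)
    (hy8 : y ≤ 1 / 8) (hεy : 4 * (ε * A ^ 2) * y ≤ 1 / 2) (hq : A ^ 2 * (1 - 4 * y) ≤ q) :
    Real.exp (-(ε * q)) ≤ 1 - denseProb ε A := by
  set l := ε * A ^ 2 with hl
  have hlpos : 0 < l := by positivity
  -- The rounding of the side costs a factor `exp (4 * l * y)`, which the polynomial factor in `1 -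
  -- denseProb` pays for with room to spare.
  have h1 : Real.exp (4 * l * y) ≤ 1 + l := by
    have h2 := Real.add_one_le_exp (-(4 * l * y))
    have h3 : (1 + l) * Real.exp (-(4 * l * y)) ≥ 1 := by
      have h4 : (1 + l) * (1 - 4 * l * y) ≥ 1 := by
        nlinarith [mul_nonneg hlpos.le (by linarith : 0 ≤ 1 / 8 - y),
          mul_nonneg hlpos.le (by linarith : 0 ≤ 1 / 2 - 4 * l * y)]
      have h5 : (1 + l) * (1 - 4 * l * y) ≤ (1 + l) * Real.exp (-(4 * l * y)) :=
        mul_le_mul_of_nonneg_left (by linarith) (by linarith)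
      linarith
    rw [Real.exp_neg, ge_iff_le, ← div_eq_mul_inv, le_div_iff₀ (Real.exp_pos _), one_mul] at h3
    exact h3
  have h2 : 1 - denseProb ε A = Real.exp (-l) * (1 + l + l ^ 2 / 2) := by
    rw [denseProb, hl]
    ring_nf
  rw [h2]
  calc Real.exp (-(ε * q)) ≤ Real.exp (-l + 4 * l * y) := by
        refine Real.exp_le_exp.2 ?_
        have := mul_le_mul_of_nonneg_left hq hε.le
        rw [hl]
        linarith
    _ = Real.exp (-l) * Real.exp (4 * l * y) := Real.exp_add _ _
    _ ≤ _ := mul_le_mul_of_nonneg_left (h1.trans (by linarith [sq_nonneg l])) (Real.exp_pos _).le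

theorem eventually_pi_real_lt_tspWeight_le {α : ℝ} (hα : 1 < α) {ε₁ ε₂ : ℝ} (hε₁ : 0 < ε₁)
    {c₁ c₂ : ℝ} (hc₁ : 0 < c₁) (hc₂ : 0 < c₂) {A : ℝ} (hA : 0 < A) (m : ℕ) :
    ∀ᶠ n : ℕ in atTop, ∀ (μ : Measure UnitSquare) (h : UnitSquare → UnitSquare → ℝ),
      IsBoundedLaw ε₁ ε₂ μ → IsEdgeWeight c₁ c₂ h →
      (Measure.pi fun _ : Fin n => μ).real {x | upperConst c₂ ε₁ ε₂ α A * (n : ℝ) ^ (1 - α / 2)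
        * (1 + 2 / (n : ℝ) ^ (1 / 16 : ℝ)) < tspWeight h α x} ≤ 1 / (n : ℝ) ^ m := by
  set p := denseProb ε₁ A with hpdef
  have hp : 0 < p := denseProb_pos hε₁ hA
  have hp1 : p < 1 := denseProb_lt_one hε₁
  set κ := -Real.log (1 - p) with hκdef
  have hκ : 0 < κ := neg_pos.2 (Real.log_neg (by linarith) (by linarith))
  -- Chosen so that runs cut off at `L ≤ n ^ η` satisfy `(L * L ^ α) ^ 2 ≤ n ^ (1 / 4)`.
  set η := 1 / (8 * (1 + α)) with hηdef
  have hη : 0 < η := by positivity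
  have hη1 : η < 1 := by
    rw [hηdef, div_lt_one (by positivity)]
    linarith
  have hy0 := tendsto_div_natCast_rpow (a := 1 / 2) (by norm_num) A
  filter_upwards [eventually_ge_atTop 1, hy0.eventually_le_const (by norm_num : (0 : ℝ) < 1 / 8),
    hy0.eventually_le_const (by positivity : 0 < 1 / (8 * (ε₁ * A ^ 2))),
    eventually_mul_rpow_le_rpow (a := 1 / 16) (b := 1 / 2) (by norm_num) (8 * A),
    eventually_mul_rpow_le_rpow hη1 (A ^ 2),
    eventually_mul_rpow_mul_exp_le (κ := 1 / 8) (η := 5 / 8) (by norm_num) (by norm_num) 1 m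
      (by norm_num : (0 : ℝ) < 1 / 2),
    eventually_mul_rpow_mul_exp_le hκ hη (9 / A ^ 2 * Real.exp κ) (m + 1)
      (by norm_num : (0 : ℝ) < 1 / 2)]
    with n hn1 hy8 hyε hn16 hnη he1 he2 μ h hμ hh
  have hprob := hμ.isProbabilityMeasure
  have hn : (0 : ℝ) < n := by exact_mod_cast hn1
  have hn' : (1 : ℝ) ≤ n := by exact_mod_cast hn1
  rw [← Real.sqrt_eq_rpow] at hy8 hyε hn16
  set s := √(n : ℝ) with hsdef
  have hs : 0 < s := Real.sqrt_pos.2 hn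
  have hss : s ^ 2 = n := Real.sq_sqrt hn.le
  set y := A / s with hydef
  have hy : 0 < y := by positivity
  set R := s / A with hRdef
  have hR : 0 < R := by positivity
  have hRy : R * y = 1 := by rw [hRdef, hydef]; field_simp
  have hR2 : R ^ 2 = n / A ^ 2 := by rw [hRdef, div_pow, hss]
  obtain ⟨M, hM, ⟨τ⟩, hM1, hM2⟩ := exists_even_side hR
  have hM' : (0 : ℝ) < M := by exact_mod_cast hM
  have hMR : (M : ℝ) ≤ R * (1 + 2 * y) := by linarith
  have hMsq : (M : ℝ) ^ 2 ≤ n / A ^ 2 * (1 + 2 * y) ^ 2 := by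
    rw [← hR2, ← mul_pow]
    exact pow_le_pow_left₀ hM'.le hMR 2
  have hMsq' : (M : ℝ) ^ 2 ≤ n / A ^ 2 * (1 + 8 * y) := by
    refine hMsq.trans (mul_le_mul_of_nonneg_left ?_ (by positivity))
    linarith [mul_le_mul_of_nonneg_left hy8 hy.le]
  have hMsq9 : (M : ℝ) ^ 2 ≤ 9 / A ^ 2 * n := by
    refine hMsq'.trans ?_
    have : (n : ℝ) / A ^ 2 * (1 + 8 * y) ≤ n / A ^ 2 * 9 :=
      mul_le_mul_of_nonneg_left (by linarith) (by positivity)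
    exact this.trans (le_of_eq (by ring))
  have hMlow : n / A ^ 2 ≤ (M : ℝ) ^ 2 := by
    rw [← hR2]
    exact pow_le_pow_left₀ hR.le hM1 2
  have hq : A ^ 2 * (1 - 4 * y) ≤ n / (M : ℝ) ^ 2 := by
    rw [le_div_iff₀ (by positivity)]
    calc A ^ 2 * (1 - 4 * y) * (M : ℝ) ^ 2
        ≤ A ^ 2 * (1 - 4 * y) * (n / A ^ 2 * (1 + 2 * y) ^ 2) :=
          mul_le_mul_of_nonneg_left hMsq (mul_nonneg (by positivity) (by linarith))
      _ = n * ((1 - 4 * y) * (1 + 2 * y) ^ 2) := by field_simp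
      _ ≤ n * 1 := by
          refine mul_le_mul_of_nonneg_left ?_ hn.le
          have h3 : 0 ≤ y ^ 3 := by positivity
          have h4 : 0 ≤ y ^ 2 := by positivity
          linarith
      _ = n := mul_one _
  have hr : Real.exp (-(ε₁ * (n / (M : ℝ) ^ 2))) ≤ 1 - p := by
    refine exp_neg_le_one_sub_denseProb hε₁ hA hy8 ?_ hq
    rw [le_div_iff₀ (by positivity)] at hyε
    linarith
  -- A positive power of `n` already makes `M ^ 2 * (1 - p) ^ L` superpolynomially small.
  set L := ⌊(n : ℝ) ^ η⌋₊ with hLdef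
  have hL1 : 1 ≤ L := Nat.one_le_floor_iff _ |>.2 (Real.one_le_rpow hn' hη.le)
  have hL0 : (0 : ℝ) < L := by exact_mod_cast hL1
  have hLle : (L : ℝ) ≤ (n : ℝ) ^ η := Nat.floor_le (by positivity)
  have hLge : (n : ℝ) ^ η - 1 ≤ L := by linarith [Nat.lt_floor_add_one ((n : ℝ) ^ η)]
  have hLM : L ≤ M ^ 2 := by
    have : (L : ℝ) ≤ (M : ℝ) ^ 2 := by
      refine (hLle.trans ?_).trans hMlow
      rw [le_div_iff₀ (by positivity), mul_comm]
      rwa [Real.rpow_one] at hnη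
    exact_mod_cast this
  -- The deviation is `n` times the relative error `n ^ (-1 / 16)`; McDiarmid's exponent is at least
  -- `n ^ (15 / 8 - 1 - 1 / 4) / 8 = n ^ (5 / 8) / 8`.
  set t := (n : ℝ) ^ (15 / 16 : ℝ) with htdef
  have ht : 0 < t := by positivity
  have key := pi_real_lt_tspWeight_le (n := n) hμ hε₁.le hM τ hα.le hLM hr hh hc₁.le hc₂.le hn1
    ht.le
  refine le_trans (measureReal_mono fun x hx => ?_) (key.trans ?_)
  · simp only [Set.mem_ofPred_eq] at hx ⊢
    refine lt_of_le_of_lt ?_ hx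
    have hS := sum_gapCoeff_mul_pow_le hp hp1 hα.le L
    have hG := add_mul_geomMoment_le hp hp1 hα.le
    set G := geomMoment p α + geomMoment (1 - p) α with hGdef
    have hG0 : 0 ≤ G := add_nonneg
      (zero_le_one.trans (one_le_geomMoment hp hp1 (by linarith)))
      (zero_le_one.trans (one_le_geomMoment (by linarith) (by linarith) (by linarith)))
    have hC : upperConst c₂ ε₁ ε₂ α A = (2 * c₂ * A) ^ α * (1 + 1 / A ^ 2 * G) := by
      rw [upperConst, deltaParam, if_neg (by linarith)]
    have hside : (2 * c₂ / M) ^ α ≤ (2 * c₂ * A) ^ α / (n : ℝ) ^ (α / 2) := by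
      have h1 : 2 * c₂ / M ≤ 2 * c₂ * A / s := by
        rw [mul_div_assoc (2 * c₂), div_eq_mul_one_div (2 * c₂)]
        refine mul_le_mul_of_nonneg_left ?_ (by positivity)
        rw [← hydef, div_le_iff₀ hM']
        linarith [mul_le_mul_of_nonneg_right hM1 hy.le]
      have h2 : s ^ α = (n : ℝ) ^ (α / 2) := by
        rw [hsdef, Real.sqrt_eq_rpow, ← Real.rpow_mul hn.le]
        ring_nf
      rw [← h2, ← Real.div_rpow (by positivity) hs.le]
      exact Real.rpow_le_rpow (by positivity) h1 (by linarith)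
    have ht16 : t = n * (1 / (n : ℝ) ^ (1 / 16 : ℝ)) := by
      rw [htdef, mul_one_div, ← Real.rpow_one_sub' hn.le (by norm_num)]
      norm_num
    have hy16 : 8 * y ≤ 1 / (n : ℝ) ^ (1 / 16 : ℝ) := by
      rw [hydef, mul_div_assoc', div_le_div_iff₀ hs (by positivity)]
      linarith
    set u := 1 / (n : ℝ) ^ (1 / 16 : ℝ) with hu
    have hu2 : 2 / (n : ℝ) ^ (1 / 16 : ℝ) = 2 * u := by rw [hu]; ring
    have hupos : 0 < u := by positivity
    -- The relative error `2 * u` pays for the excess `8 * y ≤ u` in `M ^ 2` and for the deviation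
    -- `t = n * u`.
    have hbr : n + (3 / 2) ^ α * (M : ℝ) ^ 2
        + ((M : ℝ) ^ 2 * ∑ l ∈ Finset.range L, gapCoeff α l * (1 - p) ^ l + t)
        ≤ n * ((1 + 1 / A ^ 2 * G) * (1 + 2 * u)) := by
      have h1 : (3 / 2) ^ α * (M : ℝ) ^ 2
          + (M : ℝ) ^ 2 * ∑ l ∈ Finset.range L, gapCoeff α l * (1 - p) ^ l
          ≤ n / A ^ 2 * (1 + u) * G := by
        calc _ = (M : ℝ) ^ 2 * ((3 / 2) ^ α
              + ∑ l ∈ Finset.range L, gapCoeff α l * (1 - p) ^ l) := by ring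
          _ ≤ (M : ℝ) ^ 2 * G := mul_le_mul_of_nonneg_left (by linarith) (by positivity)
          _ ≤ _ := by
              refine mul_le_mul_of_nonneg_right (hMsq'.trans ?_) hG0
              exact mul_le_mul_of_nonneg_left (by linarith) (by positivity)
      have h2 : 0 ≤ n * (1 / A ^ 2 * G * u) := by positivity
      have h3 : n * ((1 + 1 / A ^ 2 * G) * (1 + 2 * u))
          = n + n / A ^ 2 * (1 + u) * G + n * (1 / A ^ 2 * G * u) + n * u + n * u := by ring
      rw [h3, ht16]
      have : 0 < n * u := by positivity
      linarith
    calc (2 * c₂ / M) ^ α * (n + (3 / 2) ^ α * (M : ℝ) ^ 2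
        + ((M : ℝ) ^ 2 * ∑ l ∈ Finset.range L, gapCoeff α l * (1 - p) ^ l + t))
        ≤ (2 * c₂ / M) ^ α * (n * ((1 + 1 / A ^ 2 * G) * (1 + 2 * u))) :=
          mul_le_mul_of_nonneg_left hbr (by positivity)
      _ ≤ (2 * c₂ * A) ^ α / (n : ℝ) ^ (α / 2) * (n * ((1 + 1 / A ^ 2 * G) * (1 + 2 * u))) :=
          mul_le_mul_of_nonneg_right hside (by positivity)
      _ = _ := by
          rw [hC, hu2, Real.rpow_sub hn, Real.rpow_one]
          ring
  · have hnm : (0 : ℝ) < (n : ℝ) ^ m := by positivity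
    have hfirst : Real.exp (-t ^ 2 / (2 * (n * (2 * L * (L : ℝ) ^ α) ^ 2)))
        ≤ 1 / 2 / (n : ℝ) ^ m := by
      rw [le_div_iff₀ hnm]
      rw [one_mul, Real.rpow_natCast] at he1
      refine le_trans ?_ he1
      rw [mul_comm]
      refine mul_le_mul_of_nonneg_left (Real.exp_le_exp.2 ?_) hnm.le
      rw [neg_div, neg_mul]
      refine neg_le_neg ?_
      rw [le_div_iff₀ (by positivity)]
      have h1 : (L : ℝ) ^ 2 * ((L : ℝ) ^ α) ^ 2 ≤ (n : ℝ) ^ (1 / 4 : ℝ) := by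
        have h2 : (L : ℝ) ^ 2 * ((L : ℝ) ^ α) ^ 2 = (L : ℝ) ^ (2 * (1 + α)) := by
          rw [← mul_pow, mul_comm 2, Real.rpow_mul hL0.le, Real.rpow_add hL0, Real.rpow_one]
          norm_num
        have h3 : (1 / 4 : ℝ) = η * (2 * (1 + α)) := by
          rw [hηdef]
          field_simp
          norm_num
        rw [h2, h3, Real.rpow_mul hn.le]
        exact Real.rpow_le_rpow hL0.le hLle (by positivity)
      have h4 : t ^ 2 = (n : ℝ) ^ (5 / 8 : ℝ) * n * (n : ℝ) ^ (1 / 4 : ℝ) := by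
        rw [htdef, ← Real.rpow_natCast, ← Real.rpow_mul hn.le]
        nth_rewrite 3 [← Real.rpow_one (n : ℝ)]
        rw [← Real.rpow_add hn, ← Real.rpow_add hn]
        norm_num
      rw [h4]
      calc 1 / 8 * (n : ℝ) ^ (5 / 8 : ℝ) * (2 * (n * (2 * L * (L : ℝ) ^ α) ^ 2))
          = (n : ℝ) ^ (5 / 8 : ℝ) * n * ((L : ℝ) ^ 2 * ((L : ℝ) ^ α) ^ 2) := by ring
        _ ≤ _ := mul_le_mul_of_nonneg_left h1 (by positivity)
    have hsecond : (M : ℝ) ^ 2 * (1 - p) ^ L ≤ 1 / 2 / (n : ℝ) ^ m := by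
      rw [le_div_iff₀ hnm]
      refine le_trans ?_ he2
      have h1 : (1 - p) ^ L ≤ Real.exp κ * Real.exp (-κ * (n : ℝ) ^ η) := by
        have h2 : 1 - p = Real.exp (-κ) := by
          rw [hκdef, neg_neg, Real.exp_log (by linarith)]
        rw [h2, ← Real.exp_nat_mul, ← Real.exp_add]
        refine Real.exp_le_exp.2 ?_
        have := mul_le_mul_of_nonneg_left hLge hκ.le
        linarith
      rw [Real.rpow_add hn, Real.rpow_natCast, Real.rpow_one]
      calc (M : ℝ) ^ 2 * (1 - p) ^ L * (n : ℝ) ^ m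
          ≤ 9 / A ^ 2 * n * (Real.exp κ * Real.exp (-κ * (n : ℝ) ^ η)) * (n : ℝ) ^ m := by
            refine mul_le_mul_of_nonneg_right (mul_le_mul hMsq9 h1 ?_ ?_) hnm.le
            · exact pow_nonneg (by linarith) _
            · positivity
        _ = _ := by ring
    calc _ ≤ 1 / 2 / (n : ℝ) ^ m + 1 / 2 / (n : ℝ) ^ m := add_le_add hfirst hsecond
      _ = 1 / (n : ℝ) ^ m := by ring

end UpperAsymptotics

/-! ### Passage from tail bounds to moments, and from the product measure to the random nodes. -/

section Moments

open Filter Topology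

theorem eventually_pi_real_lt_upperConst_le {α : ℝ} (hα : 0 < α) {ε₁ ε₂ : ℝ} (hε₁ : 0 < ε₁)
    (hε₂ : 0 < ε₂) {c₁ c₂ : ℝ} (hc₁ : 0 < c₁) (hc₂ : 0 < c₂) {A : ℝ} (hA : 0 < A) (m : ℕ) :
    ∀ᶠ n : ℕ in atTop, ∀ (μ : Measure UnitSquare) (h : UnitSquare → UnitSquare → ℝ),
      IsBoundedLaw ε₁ ε₂ μ → IsEdgeWeight c₁ c₂ h →
      (Measure.pi fun _ : Fin n => μ).real {x | upperConst c₂ ε₁ ε₂ α A * (n : ℝ) ^ (1 - α / 2)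
        * (1 + 2 / (n : ℝ) ^ (1 / 16 : ℝ)) < tspWeight h α x} ≤ 1 / (n : ℝ) ^ m := by
  rcases le_or_gt α 1 with hα1 | hα1
  · filter_upwards [eventually_tspWeight_le_of_le_one hα hα1 hε₁ hε₂ hc₁ hc₂ hA] with n hn μ h _ hh
    have : {x : Fin n → UnitSquare | upperConst c₂ ε₁ ε₂ α A * (n : ℝ) ^ (1 - α / 2)
        * (1 + 2 / (n : ℝ) ^ (1 / 16 : ℝ)) < tspWeight h α x} = ∅ :=
      Set.eq_empty_of_forall_notMem fun x hx => not_lt.2 (hn h x hh) hx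
    rw [this, measureReal_empty]
    positivity
  · exact eventually_pi_real_lt_tspWeight_le hα1 hε₁ hc₁ hc₂ hA m

theorem upperConst_pos {α : ℝ} (hα : 0 < α) {ε₁ ε₂ : ℝ} (hε₁ : 0 < ε₁) (hε₂ : 0 < ε₂) {c₂ : ℝ}
    (hc₂ : 0 < c₂) {A : ℝ} (hA : 0 < A) : 0 < upperConst c₂ ε₁ ε₂ α A := by
  have hδ := deltaParam_pos (α := α) hε₁ hε₂
  have hp := denseProb_pos hδ hA
  have hp1 := denseProb_lt_one (A := A) hδ
  have h1 := one_le_geomMoment hp hp1 hα.le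
  have h2 := one_le_geomMoment (p := 1 - denseProb (deltaParam ε₁ ε₂ α) A) (by linarith)
    (by linarith) hα.le
  have h3 : 0 < geomMoment (denseProb (deltaParam ε₁ ε₂ α) A) α
      + geomMoment (1 - denseProb (deltaParam ε₁ ε₂ α) A) α := by linarith
  rw [upperConst]
  positivity

theorem lowerConst_nonneg {α ε₁ ε₂ c₁ A : ℝ} (hε₁ : 0 < ε₁) (hc₁ : 0 < c₁) (hA : 0 < A) :
    0 ≤ lowerConst c₁ ε₁ ε₂ α A := by
  have : 0 ≤ 1 - Real.exp (-(ε₁ * A ^ 2)) :=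
    sub_nonneg.2 (Real.exp_le_one_iff.2 (neg_nonpos.2 (by positivity)))
  rw [lowerConst]
  positivity

theorem measurable_tspWeight {c₁ c₂ : ℝ} {h : UnitSquare → UnitSquare → ℝ}
    (hh : IsEdgeWeight c₁ c₂ h) (α : ℝ) (n : ℕ) :
    Measurable fun x : Fin n → UnitSquare => tspWeight h α x := by
  have hc : ∀ σ : Equiv.Perm (Fin n),
      Measurable fun x : Fin n → UnitSquare => cycleWeight h α x σ := fun σ => by
    refine Finset.measurable_sum _ fun j _ => ?_
    have : Measurable fun x : Fin n → UnitSquare =>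
        Function.uncurry h (x (σ j), x (σ (finRotate n j))) :=
      hh.measurable.comp ((measurable_pi_apply _).prodMk (measurable_pi_apply _))
    exact this.pow_const α
  have := Finset.inf'_induction (Finset.univ_nonempty (α := Equiv.Perm (Fin n)))
    (fun σ (x : Fin n → UnitSquare) => cycleWeight h α x σ) (p := fun F => Measurable F)
    (fun _ h₁ _ h₂ => h₁.inf h₂) fun σ _ => hc σ
  convert this using 1
  ext x
  rw [tspWeight, Finset.inf'_apply]

theorem mul_one_sub_le_integral {Ω : Type*} [MeasurableSpace Ω] {P : Measure Ω} {Z : Ω → ℝ} (hZ : Integrable Z P) (hZ0 : ∀ ω, 0 ≤ Z ω) {a e : ℝ}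
    (ha : 0 ≤ a) (hp : 1 - e ≤ P.real {ω | a ≤ Z ω}) : a * (1 - e) ≤ ∫ ω, Z ω ∂P :=
  (mul_le_mul_of_nonneg_left hp ha).trans
    (mul_meas_ge_le_integral_of_nonneg (Eventually.of_forall hZ0) hZ a)

variable {Ω : Type*} [MeasurableSpace Ω] {P : Measure Ω} [IsProbabilityMeasure P]

theorem integral_le_add_mul {Z : Ω → ℝ} (hZm : Measurable Z) (hZ : Integrable Z P) {b B e : ℝ}
    (hb : 0 ≤ b) (hB0 : 0 ≤ B) (hB : ∀ ω, Z ω ≤ B) (hp : P.real {ω | b < Z ω} ≤ e) :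
    ∫ ω, Z ω ∂P ≤ b + B * e := by
  have hm : MeasurableSet {ω | b < Z ω} := measurableSet_lt measurable_const hZm
  have hi : Integrable ({ω | b < Z ω}.indicator fun _ => B) P := (integrable_const B).indicator hm
  calc ∫ ω, Z ω ∂P ≤ ∫ ω, (b + {ω | b < Z ω}.indicator (fun _ => B) ω) ∂P := by
        refine integral_mono hZ ((integrable_const b).add hi) fun ω => ?_
        by_cases h : b < Z ω
        · rw [Set.indicator_of_mem (by exact h)]
          linarith [hB ω]
        · rw [Set.indicator_of_notMem (by exact h)]
          linarith
    _ = b + B * P.real {ω | b < Z ω} := by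
        rw [integral_add (integrable_const b) hi, integral_indicator_const _ hm]
        simp [mul_comm]
    _ ≤ _ := by
        have := mul_le_mul_of_nonneg_left hp hB0
        linarith

/-- Transfers every probability to the product space on which the tail bounds are proved. -/
theorem IsIIDWithDensity.map_eq_pi {f : UnitSquare → ℝ} {X : ℕ → Ω → UnitSquare}
    (hX : IsIIDWithDensity P f X) (n : ℕ) :
    P.map (fun ω (i : Fin n) => X i ω) = Measure.pi fun _ : Fin n => P.map (X 0) := by
  have h1 : iIndepFun (fun i : Fin n => X i) P := hX.indep.precomp Fin.val_injective
  rw [(iIndepFun_iff_map_fun_eq_pi_map fun i => (hX.measurable _).aemeasurable).1 h1]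
  congr 1
  ext1 i
  rw [hX.law, hX.law]

theorem IsIIDWithDensity.isBoundedLaw {ε₁ ε₂ : ℝ} {f : UnitSquare → ℝ}
    {X : ℕ → Ω → UnitSquare} (hX : IsIIDWithDensity P f X) (hf : IsBoundedDensity ε₁ ε₂ f) :
    IsBoundedLaw ε₁ ε₂ (P.map (X 0)) where
  isProbabilityMeasure := Measure.isProbabilityMeasure_map (hX.measurable 0).aemeasurable
  lower B hB := by
    rw [hX.law, withDensity_apply _ hB, ← setLIntegral_const]
    exact lintegral_mono fun x => ENNReal.ofReal_le_ofReal (hf.lower x)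
  upper B hB := by
    rw [hX.law, withDensity_apply _ hB, ← setLIntegral_const]
    exact lintegral_mono fun x => ENNReal.ofReal_le_ofReal (hf.upper x)

/-- The constant `5 / 2` instead of `3` leaves `k * w / 2` for the exceptional event in the moment
bound. -/
theorem one_add_pow_le_of_small {w : ℝ} {k : ℕ} (hw : 0 ≤ w) (hkw : 2 * k * w ≤ 1 / 5) :
    (1 + 2 * w) ^ k ≤ 1 + 5 / 2 * k * w := by
  set v := 2 * k * w with hv
  have hv0 : 0 ≤ v := by positivity
  have h1 : (1 + 2 * w) ^ k ≤ Real.exp v := by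
    calc (1 + 2 * w) ^ k ≤ Real.exp (2 * w) ^ k :=
          pow_le_pow_left₀ (by positivity) (by linarith [Real.add_one_le_exp (2 * w)]) k
      _ = Real.exp v := by rw [← Real.exp_nat_mul, hv]; ring_nf
  have h2 : Real.exp v * (1 - v) ≤ 1 := by
    calc Real.exp v * (1 - v) ≤ Real.exp v * Real.exp (-v) :=
          mul_le_mul_of_nonneg_left (by linarith [Real.add_one_le_exp (-v)]) (Real.exp_pos _).le
      _ = 1 := by rw [← Real.exp_add]; simp
  have h3 : 1 ≤ (1 + 5 / 4 * v) * (1 - v) := by nlinarith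
  have h4 : Real.exp v ≤ 1 + 5 / 4 * v :=
    le_of_mul_le_mul_right (h2.trans h3) (by linarith)
  refine h1.trans (h4.trans (le_of_eq ?_))
  rw [hv]
  ring

end Moments

/-! ### The main theorem. -/

theorem theorem1 (α : ℝ) (hα : 0 < α) (ε₁ ε₂ : ℝ) (hε₁ : 0 < ε₁) (hε₂ : ε₁ ≤ ε₂)
    (c₁ c₂ : ℝ) (hc₁ : 0 < c₁) (hc₂ : 0 < c₂) (A : ℝ) (hA : 0 < A) (k : ℕ) (hk : 1 ≤ k) :
    ∃ n₀ : ℕ, ∀ n : ℕ, n₀ ≤ n →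
      ∀ (Ω : Type*) [MeasurableSpace Ω] (P : Measure Ω) [IsProbabilityMeasure P]
        (f : UnitSquare → ℝ) (X : ℕ → Ω → UnitSquare) (h : UnitSquare → UnitSquare → ℝ),
        IsBoundedDensity ε₁ ε₂ f → IsIIDWithDensity P f X → IsEdgeWeight c₁ c₂ h →
        P.real {ω | lowerConst c₁ ε₁ ε₂ α A * (n : ℝ) ^ (1 - α / 2)
              * (1 - 4 * √A / (n : ℝ) ^ (1 / 4 : ℝ)) ≤ TSP h α X n ω}
            ≥ 1 - Real.exp (-((n : ℝ) ^ (1 / 3 : ℝ))) ∧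
        P.real {ω | TSP h α X n ω ≤ upperConst c₂ ε₁ ε₂ α A * (n : ℝ) ^ (1 - α / 2)
              * (1 + 2 / (n : ℝ) ^ (1 / 16 : ℝ))}
            ≥ 1 - 1 / (n : ℝ) ^ (2 * k) ∧
        Integrable (fun ω => TSP h α X n ω ^ k / (n : ℝ) ^ (k * (1 - α / 2))) P ∧
        lowerConst c₁ ε₁ ε₂ α A ^ k * (1 - 37 * k * √A / (n : ℝ) ^ (1 / 4 : ℝ))
            ≤ ∫ ω, TSP h α X n ω ^ k / (n : ℝ) ^ (k * (1 - α / 2)) ∂P ∧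
        ∫ ω, TSP h α X n ω ^ k / (n : ℝ) ^ (k * (1 - α / 2)) ∂P
            ≤ upperConst c₂ ε₁ ε₂ α A ^ k * (1 + 3 * k / (n : ℝ) ^ (1 / 16 : ℝ)) := by
  have hε₂' : 0 < ε₂ := hε₁.trans_le hε₂
  set C₁ := lowerConst c₁ ε₁ ε₂ α A with hC₁
  set C₂ := upperConst c₂ ε₁ ε₂ α A with hC₂
  have hC₁0 : 0 ≤ C₁ := lowerConst_nonneg hε₁ hc₁ hA
  have hC₂0 : 0 < C₂ := upperConst_pos hα hε₁ hε₂' hc₂ hA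
  have hk' : (1 : ℝ) ≤ k := by exact_mod_cast hk
  -- The first entry serves the stated tail bound; the second makes `n ^ (k * α / 2 - m) ≤ 1 / n`,
  -- so that the exceptional event is negligible in the `k`-th moment.
  set m := max (2 * k) ⌈k * (α / 2) + 1⌉₊ with hm
  have hm2 : 2 * k ≤ m := le_max_left _ _
  have hmα : k * (α / 2) + 1 ≤ (m : ℝ) :=
    (Nat.le_ceil _).trans (by exact_mod_cast le_max_right (2 * k) ⌈k * (α / 2) + 1⌉₊)
  rw [← Filter.eventually_atTop]
  filter_upwards [Filter.eventually_ge_atTop 1,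
    eventually_le_pi_real_le_tspWeight (c₂ := c₂) hα hε₁ hε₂' hc₁ hA,
    eventually_pi_real_lt_upperConst_le hα hε₁ hε₂' hc₁ hc₂ hA m,
    (tendsto_div_natCast_rpow (a := 1 / 4) (by norm_num) √A).eventually_le_const
      (by norm_num : (0 : ℝ) < 1 / 4),
    eventually_mul_rpow_mul_exp_le (κ := 1) (η := 1 / 3) (by norm_num) (by norm_num) (1 / √A)
      (1 / 4) one_pos,
    (tendsto_div_natCast_rpow (a := 1 / 16) (by norm_num) 1).eventually_le_const
      (by positivity : (0 : ℝ) < 1 / (10 * k)),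
    eventually_mul_rpow_le_rpow (a := 1 / 16) (b := 1) (by norm_num)
      (2 * ((2 * c₂) ^ α) ^ k / C₂ ^ k)]
    with n hn1 hlow hupp hz4 hexp hw hBn Ω _ P _ f X h hf hX hh
  have hn : (0 : ℝ) < n := by exact_mod_cast hn1
  have hn' : (1 : ℝ) ≤ n := by exact_mod_cast hn1
  have hμ := hX.isBoundedLaw hf
  have hY : Measurable fun ω (i : Fin n) => X i ω :=
    measurable_pi_iff.2 fun i => hX.measurable i
  have htsp : Measurable (TSP h α X n) := (measurable_tspWeight hh α n).comp hY
  have hlow' := hlow _ h hμ hh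
  have hupp' := hupp _ h hμ hh
  rw [← hX.map_eq_pi n, map_measureReal_apply hY
    (measurableSet_le measurable_const (measurable_tspWeight hh α n))] at hlow'
  rw [← hX.map_eq_pi n, map_measureReal_apply hY
    (measurableSet_lt measurable_const (measurable_tspWeight hh α n))] at hupp'
  set d := (n : ℝ) ^ (1 - α / 2) with hd
  have hdpos : 0 < d := by positivity
  set z := √A / (n : ℝ) ^ (1 / 4 : ℝ) with hz
  have hzpos : 0 < z := by positivity
  set w := 1 / (n : ℝ) ^ (1 / 16 : ℝ) with hwdef
  have hwpos : 0 < w := by positivity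
  have hz4' : 4 * √A / (n : ℝ) ^ (1 / 4 : ℝ) = 4 * z := mul_div_assoc _ _ _
  have hz37 : 37 * k * √A / (n : ℝ) ^ (1 / 4 : ℝ) = 37 * k * z := mul_div_assoc _ _ _
  have hw2 : 2 / (n : ℝ) ^ (1 / 16 : ℝ) = 2 * w := by rw [hwdef]; ring
  have hw3 : 3 * k / (n : ℝ) ^ (1 / 16 : ℝ) = 3 * k * w := by rw [hwdef]; ring
  rw [hz4'] at hlow' ⊢
  rw [hw2] at hupp' ⊢
  rw [hz37, hw3]
  set Z : Ω → ℝ := fun ω => TSP h α X n ω / d with hZ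
  have hZk : (fun ω => TSP h α X n ω ^ k / (n : ℝ) ^ (k * (1 - α / 2))) = fun ω => Z ω ^ k := by
    ext ω
    rw [hZ, div_pow, hd, ← Real.rpow_natCast (_ ^ (1 - α / 2)), ← Real.rpow_mul hn.le, mul_comm]
  have hZm : Measurable fun ω => Z ω ^ k := (htsp.div_const d).pow_const k
  have hZ0 : ∀ ω, 0 ≤ Z ω := fun ω => div_nonneg (tspWeight_nonneg hh hc₁.le α _) hdpos.le
  -- The crude bound `n * (2 * c₂) ^ α` for the tour, divided by `n ^ (1 - α / 2)`.
  set B := (2 * c₂) ^ α * (n : ℝ) ^ (α / 2) with hB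
  have hBpos : 0 < B := by positivity
  have hZB : ∀ ω, Z ω ≤ B := fun ω => by
    rw [hZ]
    dsimp only
    rw [div_le_iff₀ hdpos]
    refine (tspWeight_le_mul hh hc₁.le hc₂.le hα.le _).trans (le_of_eq ?_)
    rw [hB, hd, mul_assoc, ← Real.rpow_add hn, add_sub_cancel, Real.rpow_one, mul_comm]
  have hZkB : ∀ ω, Z ω ^ k ≤ B ^ k := fun ω => pow_le_pow_left₀ (hZ0 ω) (hZB ω) k
  have hZi : Integrable (fun ω => Z ω ^ k) P :=
    Integrable.of_bound hZm.aestronglyMeasurable (B ^ k) (Filter.Eventually.of_forall fun ω => by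
      rw [Real.norm_eq_abs, abs_of_nonneg (pow_nonneg (hZ0 ω) k)]
      exact hZkB ω)
  rw [hZk]
  refine ⟨hlow', ?_, hZi, ?_, ?_⟩
  · have hcompl : {ω | TSP h α X n ω ≤ C₂ * d * (1 + 2 * w)}
        = {ω | C₂ * d * (1 + 2 * w) < TSP h α X n ω}ᶜ := by
      ext ω
      simp
    rw [hcompl, probReal_compl_eq_one_sub (measurableSet_lt measurable_const htsp)]
    have h1 : 1 / (n : ℝ) ^ m ≤ 1 / (n : ℝ) ^ (2 * k) :=
      one_div_le_one_div_of_le (by positivity) (pow_le_pow_right₀ hn' hm2)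
    have h2 : P.real {ω | C₂ * d * (1 + 2 * w) < TSP h α X n ω} ≤ 1 / (n : ℝ) ^ m := hupp'
    linarith
  · have h4z : 0 ≤ 1 - 4 * z := by linarith
    have ha : 0 ≤ (C₁ * (1 - 4 * z)) ^ k := pow_nonneg (mul_nonneg hC₁0 h4z) k
    have hexp' : Real.exp (-(n : ℝ) ^ (1 / 3 : ℝ)) ≤ z := by
      rw [one_div_mul_eq_div, div_le_one (by positivity), neg_one_mul] at hexp
      rw [hz, le_div_iff₀ (by positivity), mul_comm]
      exact hexp
    refine le_trans ?_ (mul_one_sub_le_integral hZi (fun ω => pow_nonneg (hZ0 ω) k) ha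
      (hlow'.trans (measureReal_mono fun ω hω => ?_)))
    · rw [mul_pow, mul_assoc (C₁ ^ k)]
      refine mul_le_mul_of_nonneg_left ?_ (pow_nonneg hC₁0 k)
      -- Bernoulli's inequality loses `4 * k * z` and the exceptional event at most `z ≤ k * z`,
      -- well within `37 * k * z`.
      have hber := one_add_mul_le_pow (a := -(4 * z)) (by linarith) k
      rw [← sub_eq_add_neg] at hber
      have hexp1 : Real.exp (-(n : ℝ) ^ (1 / 3 : ℝ)) ≤ 1 :=
        hexp'.trans (hz4.trans (by norm_num))
      have hpow1 : (1 - 4 * z) ^ k ≤ 1 := pow_le_one₀ h4z (by linarith)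
      have hzk : z ≤ k * z := le_mul_of_one_le_left hzpos.le hk'
      have hprod : (1 - 4 * z) ^ k * Real.exp (-(n : ℝ) ^ (1 / 3 : ℝ)) ≤ z :=
        (mul_le_of_le_one_left (Real.exp_pos _).le hpow1).trans hexp'
      linarith
    · have h1 : C₁ * d * (1 - 4 * z) ≤ TSP h α X n ω := hω
      refine pow_le_pow_left₀ (mul_nonneg hC₁0 h4z) ?_ k
      rw [hZ]
      dsimp only
      rw [le_div_iff₀ hdpos]
      linarith
  · have hb : 0 ≤ C₂ * (1 + 2 * w) := by positivity
    have hset : P.real {ω | (C₂ * (1 + 2 * w)) ^ k < Z ω ^ k} ≤ 1 / (n : ℝ) ^ m := by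
      refine (measureReal_mono fun ω hω => ?_).trans hupp'
      have h1 : C₂ * (1 + 2 * w) < Z ω := lt_of_pow_lt_pow_left₀ k (hZ0 ω) hω
      rw [hZ] at h1
      dsimp only at h1
      rw [lt_div_iff₀ hdpos] at h1
      have h2 : C₂ * d * (1 + 2 * w) < TSP h α X n ω := by linarith
      exact h2
    refine (integral_le_add_mul hZm hZi (pow_nonneg hb k) (pow_nonneg hBpos.le k) hZkB
      hset).trans ?_
    have hkw : 2 * k * w ≤ 1 / 5 := by
      rw [le_div_iff₀ (by positivity)] at hw
      linarith
    have hmain := one_add_pow_le_of_small hwpos.le hkw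
    have hBm : B ^ k * (1 / (n : ℝ) ^ m) ≤ ((2 * c₂) ^ α) ^ k / n := by
      rw [hB, mul_pow, mul_one_div, mul_div_assoc, div_eq_mul_one_div _ (n : ℝ)]
      refine mul_le_mul_of_nonneg_left ?_ (by positivity)
      rw [div_le_div_iff₀ (by positivity) hn, one_mul, ← Real.rpow_natCast (_ ^ (α / 2)),
        ← Real.rpow_mul hn.le, ← Real.rpow_natCast (n : ℝ) m]
      nth_rewrite 2 [← Real.rpow_one (n : ℝ)]
      rw [← Real.rpow_add hn]
      exact Real.rpow_le_rpow_of_exponent_le hn' (by linarith)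
    -- The exceptional contribution is of order `1 / n`, hence eventually below half of `w = n ^ (-1
    -- / 16)` times `C₂ ^ k`.
    have hBw : ((2 * c₂) ^ α) ^ k / n ≤ C₂ ^ k * (1 / 2 * w) := by
      rw [Real.rpow_one, div_mul_eq_mul_div, div_le_iff₀ (by positivity)] at hBn
      rw [hwdef, div_le_iff₀ hn]
      have h3 : C₂ ^ k * (1 / 2 * (1 / (n : ℝ) ^ (1 / 16 : ℝ))) * n
          = n * C₂ ^ k / (2 * (n : ℝ) ^ (1 / 16 : ℝ)) := by
        field_simp
      rw [h3, le_div_iff₀ (by positivity)]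
      linarith
    have hwk : w ≤ k * w := le_mul_of_one_le_left hwpos.le hk'
    have hC₂k : 0 < C₂ ^ k := by positivity
    have h5 := mul_le_mul_of_nonneg_left hmain hC₂k.le
    have h6 := mul_le_mul_of_nonneg_left hwk hC₂k.le
    rw [mul_pow]
    linarith
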